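/- For $k,n\ge 1$ let $S_k^n\rtimes S_n\le S_{kn}$ be the wreath product subgroup: $\sigma=(g_1,\dots,g_n;h)$ with $g_b\in S_k$, $h\in S_n$ acts on $n$ blocks of size $k$ by first letting $g_b$ permute the elements inside the $b$-th block and then permuting the blocks by $h$. For a permutation $\sigma$ let $a_i(\sigma)$ be its number of $i$-cycles ($i\ge 1$; fixed points are $1$-cycles, and $a_i(\sigma)=0$ for $i>kn$). Let $N_l\sim\mathrm{Poi}(1/l)$ and $Y_{l,m,k}\sim\mathrm{Poi}(1/k)$ ($l,k\ge 1$, $m\ge 0$) be mutually independent, and put $$X_{l,k,j}=\#\{0\le m<N_l:\ Y_{l,m,k}=j\}\quad(j\ge 0),\qquad A_i=\sum_{kl=i}\ \sum_{j=1}^\infty j\,X_{l,k,j}\quad(i\ge 1).$$ (a) $X_{l,k,j}\sim\mathrm{Poi}(p^k_j/l)$, where $p^k_j=e^{-1/k}k^{-j}/j!$ is the Poisson probability mass function with parameter $1/k$ at $j$. For every choice of one index $k=\kappa(l)$ for each $l$, the variables $X_{l,\kappa(l),j}$ ($l\ge 1$, $j\ge 0$) are mutually independent; the families $(X_{l,k,j})_{k,j}$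 are mutually independent for different $l$. (For the same $l$ and different $k$ the variables may be dependent.) The series defining $A_i$ have only finitely many non-zero terms. (b) If $\sigma$ is uniformly distributed in $S_k^n\rtimes S_n$, then, as both $k,n\to\infty$ (in any way), the random sequence $(a_i(\sigma))_{i\ge 1}$ converges in law to $(A_i)_{i\ge 1}$, that is, weakly in $\mathbb N^{\{1,2,\dots\}}$ with the product topology. (c) For every $i\ge 1$ the variable $A_i$ is square integrable, with $$\mathbb E[A_i]=\frac{\sigma_0(i)}{i},\qquad \mathrm{Var}(A_i)=\frac{\sigma_0(i)}{i}+\frac1i\sum_{l\mid i}\frac1l,$$ where $\sigma_0(i)$ is the number of divisors of $i$. -/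

import Mathlib

open MeasureTheory ProbabilityTheory Filter
open scoped NNReal

noncomputable section

namespace WreathCycles

/-! ### The wreath product subgroup of the symmetric group on `k * n` points -/

/-- The `k * n` points are the pairs (block, position in the block). The permutation
`(g₁, …, gₙ; h)` first lets `g b` act inside every block `b` and then moves the blocks by `h`. -/
def blockPerm {k n : ℕ} (g : Fin n → Equiv.Perm (Fin k)) (h : Equiv.Perm (Fin n)) :
    Equiv.Perm (Fin n × Fin k) :=
  Equiv.prodShear h g

/-- The subgroup `S_k^n ⋊ S_n` of the symmetric group on the `k * n` points. -/
def wreathSubgroup (k n : ℕ) : Subgroup (Equiv.Perm (Fin n × Fin k)) where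
  carrier := {σ | ∃ (g : Fin n → Equiv.Perm (Fin k)) (h : Equiv.Perm (Fin n)), σ = blockPerm g h}
  mul_mem' := by
    rintro _ _ ⟨g, h, rfl⟩ ⟨g', h', rfl⟩
    exact ⟨fun b => g (h' b) * g' b, h * h', Equiv.ext fun _ => rfl⟩
  one_mem' := ⟨fun _ => 1, 1, Equiv.ext fun _ => rfl⟩
  inv_mem' := by
    rintro _ ⟨g, h, rfl⟩
    exact ⟨fun b => (g (h⁻¹ b))⁻¹, h⁻¹, Equiv.ext fun _ => rfl⟩

instance (k n : ℕ) : MeasurableSpace (wreathSubgroup k n) := ⊤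

/-- The sequence `(a_i(σ))_{i ≥ 1}`, where `a_i(σ)` is the number of cycles of length `i` of `σ`,
fixed points being the cycles of length `1`. It vanishes for `i` larger than the number of
points. -/
def cycleCounts {α : Type*} [Fintype α] [DecidableEq α] (σ : Equiv.Perm α) (i : ℕ+) : ℕ :=
  σ.partition.parts.count (i : ℕ)

/-! ### The limiting variables -/

/-- The value at `j` of the probability mass function of the Poisson law with parameter `1 / k`. -/
def poissonMass (k j : ℕ) : ℝ≥0 :=
  (poissonMeasure (1 / (k : ℝ≥0)) {j}).toNNReal

/-- The sample space of the limit. For `ω = (N, Y)`, the number `N l` is the number of cycles of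
length `l` of the limiting permutation of the blocks, and `Y (l, m, k)` is the number of cycles of
length `k` attached to the `m`-th of them. -/
abbrev LimitSpace : Type := (ℕ → ℕ) × (ℕ × ℕ × ℕ → ℕ)

/-- All the coordinates are independent, `N l` is Poisson with parameter `1 / l`, and `Y (l, m, k)`
is Poisson with parameter `1 / k`. (Only indices `l ≥ 1` and `k ≥ 1` matter.) -/
def limitMeasure : Measure LimitSpace :=
  (Measure.infinitePi fun l : ℕ => poissonMeasure (1 / (l : ℝ≥0))).prod
    (Measure.infinitePi fun q : ℕ × ℕ × ℕ => poissonMeasure (1 / (q.2.2 : ℝ≥0)))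

instance : IsProbabilityMeasure limitMeasure := by
  unfold limitMeasure
  infer_instance

/-- `X_{l,k,j}`: the number of indices `m < N l` with `Y (l, m, k) = j`. -/
def X (l k j : ℕ) (ω : LimitSpace) : ℕ :=
  ((Finset.range (ω.1 l)).filter fun m => ω.2 (l, m, k) = j).card

/-- `A_i = ∑_{k l = i} ∑_j j X_{l,k,j}` (the term `j = 0` vanishes). -/
def A (ω : LimitSpace) (i : ℕ+) : ℕ :=
  ∑ q ∈ (i : ℕ).divisorsAntidiagonal, ∑' j : ℕ, j * X q.2 q.1 j ω

end WreathCycles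

end

/-!
The generating function of the cycle counts of a uniformly distributed permutation of `n` points is
the cycle index `Z_n(y)`, which satisfies `n Z_n = y 1 Z_{n-1} + ⋯ + y n Z_0`
(`sum_perm_prod_parts`). Hence `∑ Z_n(y) t^n = exp (∑ y l t^l / l)`, so that `Z(y + z)` is the Cauchy
product of `Z(y)` and `Z(z)`. Taking one of the two arguments to be the constant `1`, for which
`Z_n = 1`, shows that `Z_n(y) = ∑_{m ≤ n} Z_m(y - 1)`. If only finitely many `y l` differ from `1`,
this is a partial sum of an absolutely convergent series with sum `exp (∑ (y l - 1) / l)`, and by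
dominated convergence the limit may be taken also when `y` varies with `n`
(`tendsto_cycleIndex_atTop`).

For an element `(g; h)` of the wreath product, the cycles over a cycle `q` of `h` of length `l`
correspond to the cycles of the product of the entries of `g` along `q`, the lengths being multiplied
by `l` (`prod_orbit_shearPerm`). For uniformly distributed `g` these cycle products are independent
and uniformly distributed in `S_k` (`sum_prod_cycleProduct`). So the generating function of the cycle
counts is a composition of cycle indices: `Z_n` at the arguments `y l = Z_k(x l, x (2 l), …)`. Applying
the limit twice gives `exp (∑ (exp (∑ (x (l j) - 1) / j) - 1) / l)`.

On the limiting side, conditioning on `N` shows that this is the generating function of the `A i`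
(`integral_prod_pow_A`). The same computation, for indicators of the values of `Y`, gives the joint
law of the `X l k j` (`map_X_eq_infinitePi`). Generating functions at points of `[0,1]^ι` control
convergence in law in `ℕ^ι`: the map `c ↦ 2⁻ᶜ` embeds `ℕ^ι` into a compact cube, where the monomials
span a dense algebra by the Stone-Weierstrass theorem (`tendsto_of_tendsto_pgf`).

The moments of `A i` are obtained by conditioning on `N`, the terms with different `l` being
independent.
-/

noncomputable section

namespace WreathCycles

open Topology BoundedContinuousFunction

/-! ### Probability generating functions -/

/-- The map `c ↦ 2⁻ᶜ` from `ℕ` to the unit interval. Applied coordinatewise, it embeds `ℕ^ι` into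
a compact space, on which the monomials are (restrictions of) probability generating functions. -/
def halfPow (c : ℕ) : Set.Icc (0 : ℝ) 1 :=
  ⟨(1 / 2 : ℝ) ^ c, by positivity, pow_le_one₀ (by norm_num) (by norm_num)⟩

lemma isInducing_halfPow : IsInducing halfPow := by
  suffices h : IsInducing fun c : ℕ => (1 / 2 : ℝ) ^ c from
    IsInducing.of_comp (g := Subtype.val) continuous_of_discreteTopology continuous_subtype_val h
  refine isInducing_iff_nhds.2 fun c => ?_
  rw [nhds_discrete]
  refine le_antisymm (Filter.pure_le_iff.2 fun s hs => ?_) fun s hs => ?_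
  · obtain ⟨t, ht, hts⟩ := hs
    exact hts (mem_of_mem_nhds (x := (1 / 2 : ℝ) ^ c) ht)
  · refine ⟨Metric.ball ((1 / 2 : ℝ) ^ c) ((1 / 2) ^ (c + 1)),
      Metric.ball_mem_nhds _ (by positivity), fun a ha => ?_⟩
    have ha' : |(1 / 2 : ℝ) ^ a - (1 / 2) ^ c| < (1 / 2) ^ (c + 1) := by
      simpa [Real.dist_eq] using ha
    rw [abs_lt, pow_succ] at ha'
    obtain h | rfl | h := lt_trichotomy a c
    · have := pow_le_pow_of_le_one (by norm_num : (0 : ℝ) ≤ 1 / 2) (by norm_num) h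
      rw [Nat.succ_eq_add_one, pow_succ] at this
      have := pow_pos (by norm_num : (0 : ℝ) < 1 / 2) a
      exfalso
      linarith
    · exact hs
    · have := pow_le_pow_of_le_one (by norm_num : (0 : ℝ) ≤ 1 / 2) (by norm_num) h
      rw [Nat.succ_eq_add_one, pow_succ] at this
      exfalso
      linarith

/-- The coordinate functions of the cube `[0,1]^ι`. -/
def cubeCoord {ι : Type*} (i : ι) : (ι → Set.Icc (0 : ℝ) 1) →ᵇ ℝ :=
  BoundedContinuousFunction.mkOfCompact ⟨fun u => (u i : ℝ), by fun_prop⟩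

/-- Convergence of all the probability generating functions, at points of the unit cube, implies
convergence in law in `ℕ^ι`. -/
theorem tendsto_of_tendsto_pgf {ι κ : Type*} [Countable ι] {L : Filter κ}
    [L.IsCountablyGenerated] {μ : κ → ProbabilityMeasure (ι → ℕ)} {μ₀ : ProbabilityMeasure (ι → ℕ)}
    (h : ∀ (s : Finset ι) (x : ι → ℝ), (∀ i, x i ∈ Set.Icc (0 : ℝ) 1) →
      Tendsto (fun n => ∫ c, ∏ i ∈ s, x i ^ c i ∂(μ n : Measure (ι → ℕ))) L
        (𝓝 (∫ c, ∏ i ∈ s, x i ^ c i ∂(μ₀ : Measure (ι → ℕ))))) :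
    Tendsto μ L (𝓝 μ₀) := by
  classical
  have hind : IsInducing (Pi.map fun _ => halfPow : (ι → ℕ) → ι → Set.Icc (0 : ℝ) 1) :=
    IsInducing.piMap fun _ => isInducing_halfPow
  have hm : Measurable (Pi.map fun _ => halfPow : (ι → ℕ) → ι → Set.Icc (0 : ℝ) 1) :=
    hind.continuous.measurable
  set φ : (ι → ℕ) → ι → Set.Icc (0 : ℝ) 1 := Pi.map fun _ => halfPow with hφ
  let A : StarSubalgebra ℝ ((ι → Set.Icc (0 : ℝ) 1) →ᵇ ℝ) :=
    ⟨Algebra.adjoin ℝ (Set.range cubeCoord), fun {a} ha => by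
      rwa [show star a = a from BoundedContinuousFunction.ext fun _ => rfl]⟩
  have hA : (A.map (toContinuousMapStarₐ ℝ)).SeparatesPoints := by
    intro u v huv
    obtain ⟨i, hi⟩ := Function.ne_iff.1 huv
    refine ⟨fun u => (u i : ℝ), ⟨toContinuousMapStarₐ ℝ (cubeCoord i), ⟨cubeCoord i, ?_, rfl⟩, rfl⟩,
      fun h => hi (Subtype.ext h)⟩
    exact Algebra.subset_adjoin ⟨i, rfl⟩
  -- Every integral of a polynomial over the cube is a combination of generating functions.
  have hpoly : ∀ g ∈ A, Tendsto (fun n => ∫ u, g u ∂((μ n).map hm.aemeasurable : Measure _)) L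
      (𝓝 (∫ u, g u ∂(μ₀.map hm.aemeasurable : Measure _))) := by
    intro g hg
    replace hg : g ∈ Submodule.span ℝ (SetLike.coe (Submonoid.closure
        (Set.range (cubeCoord : ι → (ι → Set.Icc (0 : ℝ) 1) →ᵇ ℝ)))) := by
      rw [← Algebra.adjoin_eq_span]
      exact hg
    induction hg using Submodule.span_induction with
    | mem g hg =>
      obtain ⟨l, hl, rfl⟩ := Submonoid.exists_multiset_of_mem_closure hg
      obtain ⟨m, rfl⟩ : ∃ m : Multiset ι, l = m.map cubeCoord := by
        clear hg
        induction l using Multiset.induction_on with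
        | empty => exact ⟨0, rfl⟩
        | cons a l ih =>
          obtain ⟨m, rfl⟩ := ih fun y hy => hl y (Multiset.mem_cons_of_mem hy)
          obtain ⟨i, rfl⟩ := hl a (Multiset.mem_cons_self _ _)
          exact ⟨i ::ₘ m, by simp⟩
      have key (ν : ProbabilityMeasure (ι → ℕ)) :
          ∫ u, (m.map cubeCoord).prod u ∂(ν.map hm.aemeasurable : Measure _) =
          ∫ c, ∏ i ∈ m.toFinset, ((1 / 2 : ℝ) ^ m.count i) ^ c i ∂(ν : Measure (ι → ℕ)) := by
        rw [ProbabilityMeasure.toMeasure_map, integral_map hm.aemeasurable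
          (BoundedContinuousFunction.continuous _).aestronglyMeasurable]
        refine integral_congr_ae (ae_of_all _ fun c => ?_)
        have : ∀ m : Multiset ι, ∀ u, (m.map cubeCoord).prod u =
            (m.map fun i => (u i : ℝ)).prod := by
          intro m u
          induction m using Multiset.induction_on with
          | empty => simp
          | cons a m ih => simp [ih, cubeCoord]
        simp only [this]
        rw [Finset.prod_multiset_map_count]
        refine Finset.prod_congr rfl fun i _ => ?_
        simp [hφ, halfPow, ← pow_mul, mul_comm]
      simp only [key]
      exact h _ _ fun i => ⟨by positivity, pow_le_one₀ (by norm_num) (by norm_num)⟩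
    | zero => simp [tendsto_const_nhds]
    | add f g _ _ hf hg =>
      have key (ν : ProbabilityMeasure (ι → Set.Icc (0 : ℝ) 1)) :
          ∫ u, (f + g) u ∂(ν : Measure _) = ∫ u, f u ∂(ν : Measure _) + ∫ u, g u ∂(ν : Measure _) :=
        integral_add (f.integrable _) (g.integrable _)
      simp only [key]
      exact hf.add hg
    | smul a f _ hf =>
      have key (ν : ProbabilityMeasure (ι → Set.Icc (0 : ℝ) 1)) :
          ∫ u, (a • f) u ∂(ν : Measure _) = a * ∫ u, f u ∂(ν : Measure _) :=
        integral_const_mul a _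
      simp only [key]
      exact hf.const_mul a
  have hcube := ProbabilityMeasure.tendsto_of_tight_of_separatesPoints ℝ
    IsTightMeasureSet.of_compactSpace hA hpoly
  -- Open sets of `ℕ^ι` are traces of open sets of the cube, so the portmanteau theorem applies.
  refine tendsto_of_forall_isOpen_le_liminf' fun G hG => ?_
  obtain ⟨U, hU, rfl⟩ := hind.isOpen_iff.1 hG
  have := ProbabilityMeasure.le_liminf_measure_open_of_tendsto hcube hU
  simpa only [ProbabilityMeasure.toMeasure_map, Measure.map_apply hm hU.measurableSet] using this

/-- A probability measure on `ℕ^ι` is determined by its probability generating functions. -/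
theorem ext_of_pgf {ι : Type*} [Countable ι] {μ ν : Measure (ι → ℕ)} [IsProbabilityMeasure μ]
    [IsProbabilityMeasure ν]
    (h : ∀ (s : Finset ι) (x : ι → ℝ), (∀ i, x i ∈ Set.Icc (0 : ℝ) 1) →
      ∫ c, ∏ i ∈ s, x i ^ c i ∂μ = ∫ c, ∏ i ∈ s, x i ^ c i ∂ν) : μ = ν := by
  let μ' : ProbabilityMeasure (ι → ℕ) := ⟨μ, ‹_›⟩
  let ν' : ProbabilityMeasure (ι → ℕ) := ⟨ν, ‹_›⟩
  have h1 : Tendsto (fun _ : ℕ => μ') atTop (𝓝 ν') :=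
    tendsto_of_tendsto_pgf fun s x hx => by
      simpa only [μ', ν', ProbabilityMeasure.coe_mk, h s x hx] using tendsto_const_nhds
  have h2 : μ' = ν' := tendsto_nhds_unique tendsto_const_nhds h1
  exact congrArg (fun ρ : ProbabilityMeasure (ι → ℕ) => (ρ : Measure (ι → ℕ))) h2

/-! ### Poisson laws -/

lemma integral_pow_poissonMeasure (r : ℝ≥0) (x : ℝ) :
    ∫ n, x ^ n ∂poissonMeasure r = Real.exp (r * (x - 1)) := by
  rw [integral_poissonMeasure]
  have h := (NormedSpace.expSeries_div_hasSum_exp (r * x)).mul_left (Real.exp (-r))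
  rw [← Real.exp_eq_exp_ℝ, ← Real.exp_add] at h
  rw [show (r : ℝ) * (x - 1) = -r + r * x by ring, ← h.tsum_eq]
  refine tsum_congr fun n => ?_
  rw [smul_eq_mul, mul_pow]
  ring

/-- The identity `E[N g(N - 1)] = r E[g(N)]` for a Poisson variable `N` with parameter `r`, on the
level of series. -/
lemma hasSum_poisson_mul {r a : ℝ} {g : ℕ → ℝ}
    (h : HasSum (fun n : ℕ => Real.exp (-r) * r ^ n / n.factorial * g n) a) :
    HasSum (fun n : ℕ => Real.exp (-r) * r ^ n / n.factorial * (n * g (n - 1))) (r * a) := by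
  rw [← hasSum_nat_add_iff' 1]
  convert! h.mul_left r using 1
  · ext n
    rw [Nat.add_sub_cancel, Nat.factorial_succ, pow_succ]
    push_cast
    field_simp
  · simp

lemma hasSum_poisson_id (r : ℝ≥0) :
    HasSum (fun n : ℕ => Real.exp (-r) * r ^ n / n.factorial * (n : ℝ)) r := by
  simpa using hasSum_poisson_mul (r := r) (g := fun _ => 1) (a := 1)
    (by simpa using hasSum_one_poissonMeasure r)

lemma hasSum_poisson_sq (r : ℝ≥0) :
    HasSum (fun n : ℕ => Real.exp (-r) * r ^ n / n.factorial * (n : ℝ) ^ 2) (r + r ^ 2) := by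
  have h := hasSum_poisson_mul (r := r) (g := fun n => n + 1) (a := r + 1) (by
    simp only [mul_add, mul_one]
    exact (hasSum_poisson_id r).add (hasSum_one_poissonMeasure r))
  convert! h using 1
  · ext n
    cases n <;> simp [pow_two]
  · ring

lemma integrable_id_poissonMeasure (r : ℝ≥0) :
    Integrable (fun n : ℕ => (n : ℝ)) (poissonMeasure r) := by
  rw [integrable_poissonMeasure_iff]
  simpa using (hasSum_poisson_id r).summable

lemma integrable_sq_poissonMeasure (r : ℝ≥0) :
    Integrable (fun n : ℕ => (n : ℝ) ^ 2) (poissonMeasure r) := by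
  rw [integrable_poissonMeasure_iff]
  simpa using (hasSum_poisson_sq r).summable

lemma integral_id_poissonMeasure (r : ℝ≥0) : ∫ n : ℕ, (n : ℝ) ∂poissonMeasure r = r := by
  rw [integral_poissonMeasure]
  exact (hasSum_poisson_id r).tsum_eq

lemma integral_sq_poissonMeasure (r : ℝ≥0) :
    ∫ n : ℕ, (n : ℝ) ^ 2 ∂poissonMeasure r = r + r ^ 2 := by
  rw [integral_poissonMeasure]
  exact (hasSum_poisson_sq r).tsum_eq

end WreathCycles

namespace WreathCycles

open Topology
open Finset.HasAntidiagonal (antidiagonal mem_antidiagonal)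

/-! ### The cycle index of the symmetric groups as a sequence -/

/-- The cycle index `Z_n` of the symmetric group `S_n`, evaluated at the real numbers `y 1`, `y 2`,
... (the value `y 0` is irrelevant), defined by its classical recursion
`n Z_n = y 1 Z_{n-1} + ⋯ + y n Z_0`. -/
def cycleIndex (y : ℕ → ℝ) : ℕ → ℝ
  | 0 => 1
  | n + 1 => (∑ m : Fin (n + 1), y (n + 1 - m) * cycleIndex y m) / (n + 1)

lemma cycleIndex_zero (y : ℕ → ℝ) : cycleIndex y 0 = 1 := by rw [cycleIndex]

lemma cycleIndex_succ (y : ℕ → ℝ) (n : ℕ) :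
    (n + 1) * cycleIndex y (n + 1) = ∑ p ∈ antidiagonal n, y (p.1 + 1) * cycleIndex y p.2 := by
  rw [cycleIndex, mul_div_cancel₀ _ (by positivity),
    ← Finset.Nat.sum_antidiagonal_swap,
    Finset.Nat.sum_antidiagonal_eq_sum_range_succ_mk, ← Fin.sum_univ_eq_sum_range
      (fun m => y ((m, n - m).swap.1 + 1) * cycleIndex y (m, n - m).swap.2)]
  refine Finset.sum_congr rfl fun m _ => ?_
  simp only [Prod.swap]
  rw [show n + 1 - (m : ℕ) = n - m + 1 by omega]

lemma cycleIndex_unique {y : ℕ → ℝ} {c : ℕ → ℝ} (h0 : c 0 = 1)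
    (h : ∀ n : ℕ, (n + 1) * c (n + 1) = ∑ p ∈ antidiagonal n, y (p.1 + 1) * c p.2) :
    c = cycleIndex y := by
  funext n
  induction n using Nat.strong_induction_on with
  | _ n ih =>
    cases n with
    | zero => rw [h0, cycleIndex_zero]
    | succ n =>
      have hn : ((n : ℝ) + 1) ≠ 0 := by positivity
      refine mul_left_cancel₀ hn ?_
      rw [h, cycleIndex_succ]
      refine Finset.sum_congr rfl fun p hp => ?_
      rw [ih p.2 (by have := mem_antidiagonal.1 hp; omega)]

open PowerSeries in
/-- The generating function of the cycle indices is `exp (∑ y l t^l / l)`, hence turns sums into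
products. -/
lemma cycleIndex_add (y z : ℕ → ℝ) (n : ℕ) :
    cycleIndex (y + z) n =
      ∑ p ∈ antidiagonal n, cycleIndex y p.1 * cycleIndex z p.2 := by
  have hd (y : ℕ → ℝ) : derivative ℝ (mk (cycleIndex y)) =
      mk (fun n => y (n + 1)) * mk (cycleIndex y) := by
    ext n
    rw [coeff_derivative, coeff_mul, coeff_mk, mul_comm, cycleIndex_succ]
    simp
  have hc : (fun n => ∑ p ∈ antidiagonal n, cycleIndex y p.1 * cycleIndex z p.2) =
      cycleIndex (y + z) := by
    have hcoeff (n : ℕ) : ∑ p ∈ antidiagonal n, cycleIndex y p.1 * cycleIndex z p.2 =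
        coeff n (mk (cycleIndex y) * mk (cycleIndex z)) := by
      simp [coeff_mul]
    refine cycleIndex_unique (by simp [cycleIndex_zero]) fun n => ?_
    have h : derivative ℝ (mk (cycleIndex y) * mk (cycleIndex z)) =
        mk (fun n => (y + z) (n + 1)) * (mk (cycleIndex y) * mk (cycleIndex z)) := by
      rw [Derivation.leibniz, hd, hd,
        show mk (fun n => (y + z) (n + 1)) = mk (fun n => y (n + 1)) + mk fun n => z (n + 1) from
          PowerSeries.ext fun n => by simp]
      simp only [smul_eq_mul]
      ring
    have hn := congrArg (coeff n) h
    rw [coeff_derivative, mul_comm] at hn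
    simp only [hcoeff]
    rw [hn, coeff_mul]
    simp only [coeff_mk]
  exact (congrFun hc n).symm

lemma cycleIndex_const_one (n : ℕ) : cycleIndex (fun _ => 1) n = 1 := by
  refine (congrFun (cycleIndex_unique (c := fun _ => 1) rfl fun n => ?_) n).symm
  simp

lemma cycleIndex_eq_sum_range (y : ℕ → ℝ) (n : ℕ) :
    cycleIndex y n = ∑ m ∈ Finset.range (n + 1), cycleIndex (fun l => y l - 1) m := by
  have h := cycleIndex_add (fun l => y l - 1) (fun _ => 1) n
  rw [show (fun l => y l - 1) + (fun _ => (1 : ℝ)) = y from funext fun l => by simp] at h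
  simp only [h, cycleIndex_const_one, mul_one, Finset.Nat.sum_antidiagonal_eq_sum_range_succ_mk]

lemma cycleIndex_nonneg {y : ℕ → ℝ} (hy : ∀ l, 0 ≤ y l) (n : ℕ) : 0 ≤ cycleIndex y n := by
  induction n using Nat.strong_induction_on with
  | _ n ih =>
    cases n with
    | zero => simp [cycleIndex_zero]
    | succ n =>
      rw [cycleIndex]
      exact div_nonneg (Finset.sum_nonneg fun m _ => mul_nonneg (hy _) (ih m m.2)) (by positivity)

lemma abs_cycleIndex_le {y z : ℕ → ℝ} (h : ∀ l, |y l| ≤ z l) (n : ℕ) :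
    |cycleIndex y n| ≤ cycleIndex z n := by
  induction n using Nat.strong_induction_on with
  | _ n ih =>
    cases n with
    | zero => simp [cycleIndex_zero]
    | succ n =>
      rw [cycleIndex, cycleIndex, abs_div, abs_of_pos (by positivity : (0 : ℝ) < n + 1)]
      gcongr
      refine (Finset.abs_sum_le_sum_abs _ _).trans (Finset.sum_le_sum fun m _ => ?_)
      rw [abs_mul]
      exact mul_le_mul (h _) (ih m m.2) (abs_nonneg _) ((abs_nonneg _).trans (h _))

lemma tendsto_cycleIndex {ι : Type*} {L : Filter ι} {y : ι → ℕ → ℝ} {z : ℕ → ℝ}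
    (h : ∀ l, 0 < l → Tendsto (fun i => y i l) L (𝓝 (z l))) (n : ℕ) :
    Tendsto (fun i => cycleIndex (y i) n) L (𝓝 (cycleIndex z n)) := by
  induction n using Nat.strong_induction_on with
  | _ n ih =>
    cases n with
    | zero => simp [cycleIndex_zero, tendsto_const_nhds]
    | succ n =>
      simp only [cycleIndex]
      refine Tendsto.div_const (tendsto_finsetSum _ fun m _ => ?_) _
      exact (h (n + 1 - m) (by have := m.2; omega)).mul (ih m m.2)

lemma cycleIndex_congr {y z : ℕ → ℝ} (h : ∀ l, 0 < l → y l = z l) (n : ℕ) :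
    cycleIndex y n = cycleIndex z n := by
  induction n using Nat.strong_induction_on with
  | _ n ih =>
    cases n with
    | zero => simp [cycleIndex_zero]
    | succ n =>
      simp only [cycleIndex]
      congr 1
      exact Finset.sum_congr rfl fun m _ => by rw [h (n + 1 - m) (by have := m.2; omega), ih m m.2]

/-- For a single non-zero variable `y l = a`, the cycle index is `(a / l) ^ r / r!` in degree
`l * r` and vanishes in the other degrees. -/
lemma hasSum_cycleIndex_single {l : ℕ} (hl : 0 < l) (a : ℝ) :
    Summable (fun n => |cycleIndex (Pi.single l a) n|) ∧
      HasSum (cycleIndex (Pi.single l a)) (Real.exp (a / l)) := by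
  have hval : (fun n => if l ∣ n then (a / l) ^ (n / l) / (n / l).factorial else 0) =
      cycleIndex (Pi.single l a) := by
    refine cycleIndex_unique (by simp) fun n => ?_
    obtain ⟨l, rfl⟩ : ∃ k, l = k + 1 := ⟨l - 1, by omega⟩
    by_cases hn : l ≤ n
    · rw [Finset.sum_eq_single (l, n - l)]
      · have hdvd : l + 1 ∣ n - l ↔ l + 1 ∣ n + 1 := by
          rw [show n + 1 = n - l + (l + 1) by omega]
          simp
        simp only [Pi.single_eq_same, hdvd]
        split_ifs with h
        · obtain ⟨r, hr⟩ := h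
          have hr0 : r ≠ 0 := by rintro rfl; omega
          obtain ⟨r, rfl⟩ := Nat.exists_eq_succ_of_ne_zero hr0
          have h1 : n - l = (l + 1) * r := by
            have : (l + 1) * r.succ = (l + 1) * r + (l + 1) := Nat.mul_succ _ _
            omega
          rw [hr, h1, Nat.mul_div_cancel_left _ hl, Nat.mul_div_cancel_left _ hl,
            Nat.succ_eq_add_one, pow_succ, Nat.factorial_succ]
          have h2 : (n : ℝ) + 1 = (l + 1) * (r + 1) := by exact_mod_cast hr
          rw [h2]
          push_cast
          field_simp
        · simp
      · intro p hp hne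
        have : p.1 + 1 ≠ l + 1 := by
          rintro h
          have := mem_antidiagonal.1 hp
          exact hne (Prod.ext_iff.2 ⟨by dsimp only; omega, by dsimp only; omega⟩)
        simp [Pi.single_eq_of_ne this]
      · intro h
        exact absurd (mem_antidiagonal.2 (by simp; omega)) h
    · rw [Finset.sum_eq_zero, if_neg, mul_zero]
      · exact fun h => by have := Nat.le_of_dvd (by omega) h; omega
      · intro p hp
        have : p.1 + 1 ≠ l + 1 := by have := mem_antidiagonal.1 hp; omega
        simp [Pi.single_eq_of_ne this]
  have hinj : Function.Injective fun r : ℕ => l * r := fun r s h => Nat.eq_of_mul_eq_mul_left hl h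
  have hout : ∀ n ∉ Set.range (fun r : ℕ => l * r), cycleIndex (Pi.single l a) n = 0 := by
    intro n hn
    rw [← hval]
    exact if_neg fun ⟨r, hr⟩ => hn ⟨r, hr.symm⟩
  have hin : cycleIndex (Pi.single l a) ∘ (fun r : ℕ => l * r) =
      fun r => (a / l) ^ r / r.factorial := by
    funext r
    rw [← hval]
    simp [Nat.mul_div_cancel_left _ hl]
  have hsum : HasSum (fun r : ℕ => (a / l) ^ r / r.factorial) (Real.exp (a / l)) := by
    rw [Real.exp_eq_exp_ℝ]
    exact NormedSpace.expSeries_div_hasSum_exp (a / l)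
  constructor
  · refine (hinj.summable_iff fun n hn => by rw [hout n hn, abs_zero]).1 ?_
    have : (fun n => |cycleIndex (Pi.single l a) n|) ∘ (fun r : ℕ => l * r) =
        fun r => |(a / l) ^ r / r.factorial| :=
      funext fun r => congrArg abs (congrFun hin r)
    rw [this]
    exact (NormedSpace.expSeries_div_summable (a / l : ℝ)).abs
  · rw [← hinj.hasSum_iff hout, hin]
    exact hsum

/-- The value at `t = 1` of the generating function `exp (∑ y l t^l / l)` of the cycle indices, when
only finitely many `y l` are non-zero. -/
lemma hasSum_cycleIndex (s : Finset ℕ) (hs : ∀ l ∈ s, 0 < l) (y : ℕ → ℝ) :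
    Summable (fun n => |cycleIndex (∑ l ∈ s, Pi.single l (y l)) n|) ∧
      HasSum (cycleIndex (∑ l ∈ s, Pi.single l (y l))) (Real.exp (∑ l ∈ s, y l / l)) := by
  classical
  induction s using Finset.induction_on with
  | empty =>
    have h : cycleIndex (∑ l ∈ (∅ : Finset ℕ), Pi.single l (y l)) = Pi.single 0 1 := by
      refine (cycleIndex_unique (by simp) fun n => ?_).symm
      simp
    rw [h]
    refine ⟨?_, by simpa using hasSum_pi_single 0 (1 : ℝ)⟩
    exact summable_of_ne_finset_zero (s := {0}) fun n hn => by
      simp [Pi.single_eq_of_ne (by simpa using hn : n ≠ 0)]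
  | insert l s hl ih =>
    obtain ⟨ih1, ih2⟩ := ih fun m hm => hs m (Finset.mem_insert_of_mem hm)
    obtain ⟨h1, h2⟩ := hasSum_cycleIndex_single (hs l (Finset.mem_insert_self _ _)) (y l)
    have hadd : cycleIndex (∑ l ∈ insert l s, Pi.single l (y l)) = fun n =>
        ∑ p ∈ antidiagonal n, cycleIndex (Pi.single l (y l)) p.1 *
          cycleIndex (∑ l ∈ s, Pi.single l (y l)) p.2 := by
      funext n
      rw [Finset.sum_insert hl, cycleIndex_add]
    set F := cycleIndex (Pi.single l (y l)) with hF
    set G := cycleIndex (∑ l ∈ s, Pi.single l (y l)) with hG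
    have h1' : Summable fun n => ‖F n‖ := h1
    have ih1' : Summable fun n => ‖G n‖ := ih1
    have habs := summable_norm_sum_mul_antidiagonal_of_summable_norm h1' ih1'
    rw [hadd, Finset.sum_insert hl, Real.exp_add, ← h2.tsum_eq, ← ih2.tsum_eq,
      tsum_mul_tsum_eq_tsum_sum_antidiagonal_of_summable_norm h1' ih1']
    exact ⟨habs, habs.of_norm.hasSum⟩

/-- If `y i l → z l` for all `l`, where `0 ≤ y i l ≤ 1` and `y i l = 1` for `l > b`, then the cycle
indices of `S_n` at `y i` tend to the generating function of independent Poisson variables. -/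
theorem tendsto_cycleIndex_atTop {ι : Type*} {L : Filter ι} {y : ι → ℕ → ℝ} {z : ℕ → ℝ} {N : ι → ℕ}
    (hN : Tendsto N L atTop) {b : ℕ} (hy : ∀ i l, y i l ∈ Set.Icc (0 : ℝ) 1)
    (hyb : ∀ i l, b < l → y i l = 1)
    (h : ∀ l, 0 < l → Tendsto (fun i => y i l) L (𝓝 (z l))) :
    Tendsto (fun i => cycleIndex (y i) (N i)) L
      (𝓝 (Real.exp (∑ l ∈ Finset.Icc 1 b, (z l - 1) / l))) := by
  obtain rfl | hL := L.eq_or_neBot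
  · simp
  have hsingle (w : ℕ → ℝ) (l : ℕ) :
      (∑ m ∈ Finset.Icc 1 b, Pi.single m (w m) : ℕ → ℝ) l =
        if l ∈ Finset.Icc 1 b then w l else 0 := by
    rw [Finset.sum_apply, Finset.sum_pi_single]
  have hzb : ∀ l, b < l → z l = 1 := fun l hl => by
    refine tendsto_nhds_unique (h l (by omega)) ?_
    simp only [hyb _ l hl, tendsto_const_nhds]
  have hcut (w : ℕ → ℝ) (hw : ∀ l, b < l → w l = 1) (n : ℕ) : cycleIndex (fun l => w l - 1) n =
      cycleIndex (∑ m ∈ Finset.Icc 1 b, Pi.single m (w m - 1)) n := by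
    refine cycleIndex_congr (fun l hl => ?_) n
    rw [hsingle (fun m => w m - 1)]
    split_ifs with hlb
    · rfl
    · rw [hw l (by simp at hlb; omega), sub_self]
  obtain ⟨-, hlim⟩ := hasSum_cycleIndex (Finset.Icc 1 b)
    (fun l hl => (Finset.mem_Icc.1 hl).1) (fun l => z l - 1)
  obtain ⟨hdom, -⟩ := hasSum_cycleIndex (Finset.Icc 1 b)
    (fun l hl => (Finset.mem_Icc.1 hl).1) (fun _ => 1)
  rw [← hlim.tsum_eq]
  simp only [← hcut z hzb]
  have hfin (i : ι) : cycleIndex (y i) (N i) =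
      ∑' m, if m < N i + 1 then cycleIndex (fun l => y i l - 1) m else 0 := by
    rw [cycleIndex_eq_sum_range, tsum_eq_sum (s := Finset.range (N i + 1))]
    · exact Finset.sum_congr rfl fun m hm => by rw [if_pos (Finset.mem_range.1 hm)]
    · exact fun m hm => if_neg fun h => hm (Finset.mem_range.2 h)
  simp only [hfin]
  refine tendsto_tsum_of_dominated_convergence hdom (fun m => ?_) (.of_forall fun i m => ?_)
  · refine (tendsto_cycleIndex (fun l hl => (h l hl).sub_const 1) m).congr' ?_
    filter_upwards [hN.eventually_ge_atTop m] with i hi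
    rw [if_pos (by omega)]
  · have h0 : 0 ≤ cycleIndex (∑ l ∈ Finset.Icc 1 b, Pi.single l 1) m :=
      cycleIndex_nonneg (fun l => by rw [hsingle fun _ => 1]; split_ifs <;> norm_num) m
    rw [abs_of_nonneg h0, Real.norm_eq_abs]
    split_ifs
    · rw [hcut _ (hyb i)]
      refine abs_cycleIndex_le (fun l => ?_) m
      rw [hsingle fun _ => 1, hsingle fun m => y i m - 1]
      split_ifs
      · have := hy i l
        rw [abs_le]
        constructor <;> linarith [this.1, this.2]
      · simp
    · simpa using h0

end WreathCycles

namespace WreathCycles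

open Finset.HasAntidiagonal (antidiagonal mem_antidiagonal)

/-! ### The cycle index as an average over permutations -/

/-- The contribution of the permutations with cycle lengths `m` (fixed points included) to the cycle
index. -/
def cycleWeight (y : ℕ → ℝ) (m : Multiset ℕ) : ℝ :=
  (m.map fun l => y l / l).prod / ∏ l ∈ m.toFinset, ((m.count l).factorial : ℝ)

lemma prod_count_factorial_cons (a : ℕ) (m : Multiset ℕ) :
    ∏ l ∈ (a ::ₘ m).toFinset, (((a ::ₘ m).count l).factorial : ℝ) =
      (m.count a + 1) * ∏ l ∈ m.toFinset, ((m.count l).factorial : ℝ) := by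
  have ha : a ∈ (a ::ₘ m).toFinset := by simp
  have hsub : m.toFinset ⊆ (a ::ₘ m).toFinset := by simp [Multiset.toFinset_cons]
  rw [Finset.prod_subset hsub fun l _ hl => by
      rw [Multiset.count_eq_zero_of_notMem (by simpa using hl)]; simp,
    ← Finset.mul_prod_erase _ _ ha, ← Finset.mul_prod_erase _ _ ha, Multiset.count_cons_self,
    Nat.factorial_succ]
  push_cast
  rw [mul_assoc]
  congr 2
  refine Finset.prod_congr rfl fun l hl => ?_
  rw [Multiset.count_cons_of_ne (Finset.ne_of_mem_erase hl)]

lemma cycleWeight_cons (y : ℕ → ℝ) {l : ℕ} (hl : 0 < l) (m : Multiset ℕ) :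
    l * (l ::ₘ m).count l * cycleWeight y (l ::ₘ m) = y l * cycleWeight y m := by
  have h : ∏ l ∈ m.toFinset, ((m.count l).factorial : ℝ) ≠ 0 :=
    Finset.prod_ne_zero_iff.2 fun l _ => by positivity
  rw [cycleWeight, cycleWeight, prod_count_factorial_cons, Multiset.map_cons, Multiset.prod_cons,
    Multiset.count_cons_self]
  push_cast
  field_simp

lemma sum_partition_cycleWeight (y : ℕ → ℝ) (n : ℕ) :
    ∑ p : n.Partition, cycleWeight y p.parts = cycleIndex y n := by
  refine congrFun (cycleIndex_unique (c := fun n => ∑ p : n.Partition, cycleWeight y p.parts)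
    ?_ fun n => ?_) n
  · simp [cycleWeight]
  -- `n + 1` is the sum of the parts of `p`; removing a part gives a partition of a smaller number.
  have h1 (p : (n + 1).Partition) : ((n : ℝ) + 1) * cycleWeight y p.parts =
      ∑ l ∈ p.parts.toFinset, y l * cycleWeight y (p.parts.erase l) := by
    have hsum : ((n : ℝ) + 1) = ∑ l ∈ p.parts.toFinset, (l : ℝ) * p.parts.count l := by
      have := p.parts_sum
      rw [Finset.sum_multiset_count] at this
      have h := congrArg (Nat.cast (R := ℝ)) this
      push_cast at h
      rw [← h]
      exact Finset.sum_congr rfl fun l _ => by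
        rw [nsmul_eq_mul, Nat.cast_mul, Nat.cast_id, mul_comm]
    rw [hsum, Finset.sum_mul]
    refine Finset.sum_congr rfl fun l hl => ?_
    have hl := Multiset.mem_toFinset.1 hl
    obtain ⟨m, hm⟩ := Multiset.exists_cons_of_mem hl
    rw [hm, Multiset.erase_cons_head, cycleWeight_cons y (p.parts_pos hl)]
  rw [Finset.mul_sum]
  simp only [h1, Finset.mul_sum]
  rw [Finset.sum_sigma', Finset.sum_sigma']
  symm
  refine Finset.sum_bij
    (fun (x : (_ : ℕ × ℕ) × Nat.Partition _) hx =>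
      ⟨⟨(x.1.1 + 1) ::ₘ x.2.parts, fun {i} hi => by
        obtain rfl | hi := Multiset.mem_cons.1 hi
        · omega
        · exact x.2.parts_pos hi, by
        have := mem_antidiagonal.1 (Finset.mem_sigma.1 hx).1
        rw [Multiset.sum_cons, x.2.parts_sum]
        omega⟩, x.1.1 + 1⟩) ?_ ?_ ?_ ?_
  · intro x hx
    simp
  · rintro ⟨⟨a, b⟩, p⟩ hx ⟨⟨a', b'⟩, p'⟩ hx' h
    have ha := mem_antidiagonal.1 (Finset.mem_sigma.1 hx).1
    have ha' := mem_antidiagonal.1 (Finset.mem_sigma.1 hx').1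
    dsimp only at ha ha'
    simp only [Sigma.mk.injEq, heq_eq_eq, Nat.Partition.ext_iff] at h
    obtain ⟨h, hab⟩ := h
    obtain rfl : a = a' := by omega
    obtain rfl : b = b' := by omega
    have : p = p' := Nat.Partition.ext ((Multiset.cons_inj_right _).1 h)
    rw [this]
  · rintro ⟨p, l⟩ hl
    have hl := Multiset.mem_toFinset.1 (Finset.mem_sigma.1 hl).2
    have hpos := p.parts_pos hl
    have hcons := Multiset.cons_erase hl
    dsimp only at hl hpos hcons
    have hsum : l + (p.parts.erase l).sum = n + 1 := by
      rw [← Multiset.sum_cons, hcons, p.parts_sum]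
    refine ⟨⟨(l - 1, n - (l - 1)), ⟨p.parts.erase l,
      fun {i} hi => p.parts_pos (Multiset.mem_of_mem_erase hi), by dsimp only; omega⟩⟩, ?_, ?_⟩
    · simp only [Finset.mem_sigma, mem_antidiagonal, Finset.mem_univ, and_true]
      omega
    · have hl1 : l - 1 + 1 = l := by omega
      simp [hl1, hcons]
  · rintro ⟨⟨a, b⟩, p⟩ hx
    simp

variable {α : Type*} [Fintype α] [DecidableEq α]

lemma partition_parts_eq {n : ℕ} (p : n.Partition) :
    p.parts = p.parts.filter (2 ≤ ·) +
      Multiset.replicate (n - (p.parts.filter (2 ≤ ·)).sum) 1 := by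
  have h1 : p.parts.filter (fun l => ¬ 2 ≤ l) =
      Multiset.replicate (p.parts.filter (fun l => ¬ 2 ≤ l)).card 1 :=
    Multiset.eq_replicate_of_mem fun l hl => by
      have := p.parts_pos (Multiset.mem_filter.1 hl).1
      have := (Multiset.mem_filter.1 hl).2
      omega
  have h2 := congrArg Multiset.sum (Multiset.filter_add_not (2 ≤ ·) p.parts)
  rw [p.parts_sum, h1, Multiset.sum_add, Multiset.sum_replicate, smul_eq_mul, mul_one] at h2
  conv_lhs => rw [← Multiset.filter_add_not (2 ≤ ·) p.parts, h1]
  rw [show n - (p.parts.filter (2 ≤ ·)).sum = (p.parts.filter (fun l => ¬ 2 ≤ l)).card by omega]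

/-- This restates the formula for the number of permutations with given lengths of the non-trivial
cycles, fixed points being counted as parts equal to `1`. -/
lemma card_partition_mul_prod (p : (Fintype.card α).Partition) (y : ℕ → ℝ) :
    (Finset.univ.filter fun g : Equiv.Perm α => g.partition = p).card * (p.parts.map y).prod =
      (Fintype.card α).factorial * cycleWeight y p.parts := by
  set m := p.parts.filter (2 ≤ ·) with hm
  have hp : p.parts = m + Multiset.replicate (Fintype.card α - m.sum) 1 := partition_parts_eq p
  have hm2 : ∀ a ∈ m, 2 ≤ a := fun a ha => (Multiset.mem_filter.1 ha).2
  have hms : m.sum ≤ Fintype.card α := by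
    have := congrArg Multiset.sum hp
    rw [p.parts_sum, Multiset.sum_add] at this
    omega
  have hfilter (g : Equiv.Perm α) : g.partition = p ↔ g.cycleType = m := by
    constructor
    · rintro rfl
      exact Equiv.Perm.filter_parts_partition_eq_cycleType.symm
    · intro h
      refine Nat.Partition.ext ?_
      rw [hp, Equiv.Perm.parts_partition, ← Equiv.Perm.sum_cycleType, h]
  have hcard := Equiv.Perm.card_of_cycleType_mul_eq α m
  rw [if_pos ⟨hms, hm2⟩] at hcard
  simp only [hfilter]
  have h1m : 1 ∉ m := fun h => by have := hm2 1 h; omega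
  have hprod : (p.parts.map (Nat.cast : ℕ → ℝ)).prod = (m.prod : ℝ) := by
    rw [hp, Multiset.map_add, Multiset.prod_add, Multiset.map_replicate]
    simp [Nat.cast_multiset_prod]
  have hfact : ∏ l ∈ p.parts.toFinset, ((p.parts.count l).factorial : ℝ) =
      (Fintype.card α - m.sum).factorial * ∏ l ∈ m.toFinset, ((m.count l).factorial : ℝ) := by
    rw [Finset.prod_subset (s₁ := p.parts.toFinset) (s₂ := insert 1 m.toFinset),
      Finset.prod_insert (by simpa using h1m)]
    · congr 1
      · rw [hp, Multiset.count_add, Multiset.count_eq_zero_of_notMem h1m]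
        simp
      · refine Finset.prod_congr rfl fun l hl => ?_
        have hl1 : l ≠ 1 := by
          rintro rfl
          exact h1m (Multiset.mem_toFinset.1 hl)
        rw [hp, Multiset.count_add, Multiset.count_replicate, if_neg hl1.symm, add_zero]
    · intro l hl
      rw [Multiset.mem_toFinset, hp, Multiset.mem_add] at hl
      rcases hl with hl | hl
      · exact Finset.mem_insert_of_mem (Multiset.mem_toFinset.2 hl)
      · rw [Multiset.eq_of_mem_replicate hl]
        exact Finset.mem_insert_self _ _
    · intro l _ hl
      rw [Multiset.count_eq_zero_of_notMem (by simpa using hl)]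
      simp
  have hm0 : (m.prod : ℝ) ≠ 0 := by
    have : 0 < m.prod := Multiset.prod_pos fun a ha => by have := hm2 a ha; omega
    positivity
  have hf0 : ∏ l ∈ m.toFinset, ((m.count l).factorial : ℝ) ≠ 0 :=
    Finset.prod_ne_zero_iff.2 fun l _ => by positivity
  have hn0 : ((Fintype.card α - m.sum).factorial : ℝ) ≠ 0 := by positivity
  have hcard' := congrArg (Nat.cast (R := ℝ)) hcard
  rw [Nat.cast_mul, Nat.cast_mul, Nat.cast_mul, Nat.cast_prod] at hcard'
  rw [cycleWeight, hfact, Multiset.prod_map_div, hprod, ← hcard', div_div, mul_div_assoc',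
    eq_div_iff (mul_ne_zero hm0 (mul_ne_zero hn0 hf0))]
  ring

/-- The recursively defined cycle index is the average, over all permutations, of the product of
`y l` over the lengths `l` of the cycles. -/
theorem sum_perm_prod_parts (y : ℕ → ℝ) :
    ∑ g : Equiv.Perm α, (g.partition.parts.map y).prod =
      (Fintype.card α).factorial * cycleIndex y (Fintype.card α) := by
  rw [← Finset.sum_fiberwise Finset.univ (fun g : Equiv.Perm α => g.partition),
    ← sum_partition_cycleWeight, Finset.mul_sum]
  refine Finset.sum_congr rfl fun p _ => ?_
  rw [← card_partition_mul_prod, ← nsmul_eq_mul, ← Finset.sum_const]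
  refine Finset.sum_congr rfl fun g hg => ?_
  rw [(Finset.mem_filter.1 hg).2]

end WreathCycles

namespace WreathCycles

/-! ### Cycles as orbits -/

open Function

variable {α : Type*}

/-- The set of all cycles of a permutation, fixed points included. -/
def Orbit (σ : Equiv.Perm α) : Type _ := Quotient (Equiv.Perm.SameCycle.setoid σ)

namespace Orbit

variable {σ : Equiv.Perm α}

/-- The cycle through a point. -/
def mk (σ : Equiv.Perm α) (a : α) : Orbit σ := Quotient.mk (Equiv.Perm.SameCycle.setoid σ) a

/-- A chosen point of a cycle. -/
def out (q : Orbit σ) : α := Quotient.out q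

@[simp] lemma mk_out (q : Orbit σ) : mk σ q.out = q := Quotient.out_eq q

lemma mk_eq_mk {a b : α} : mk σ a = mk σ b ↔ σ.SameCycle a b := Quotient.eq

lemma out_mk (a : α) : σ.SameCycle (mk σ a).out a := mk_eq_mk.1 (mk_out _)

/-- The length of a cycle. -/
def len (q : Orbit σ) : ℕ := minimalPeriod σ q.out

instance [Finite α] : Finite (Orbit σ) := inferInstanceAs (Finite (Quotient _))

instance [Fintype α] : Fintype (Orbit σ) := Fintype.ofFinite _

instance : DecidableEq (Orbit σ) := Classical.decEq _

end Orbit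

open Orbit

variable {σ : Equiv.Perm α}

lemma mem_periodicPts_perm [Finite α] (σ : Equiv.Perm α) (a : α) : a ∈ periodicPts σ := by
  refine ⟨orderOf σ, orderOf_pos σ, ?_⟩
  rw [IsPeriodicPt, IsFixedPt, ← Equiv.Perm.coe_pow, pow_orderOf_eq_one, Equiv.Perm.one_apply]

lemma sameCycle_iff_exists_iterate [Finite α] {a b : α} :
    σ.SameCycle a b ↔ ∃ n < minimalPeriod σ a, σ^[n] a = b := by
  constructor
  · intro h
    obtain ⟨n, -, hn⟩ := h.exists_pow_eq'
    refine ⟨n % minimalPeriod σ a, Nat.mod_lt _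
      (minimalPeriod_pos_of_mem_periodicPts (mem_periodicPts_perm σ a)), ?_⟩
    rw [iterate_mod_minimalPeriod_eq, ← hn, Equiv.Perm.coe_pow]
  · rintro ⟨n, -, rfl⟩
    exact ⟨n, by rw [zpow_natCast, Equiv.Perm.coe_pow]⟩

lemma minimalPeriod_eq_of_sameCycle [Finite α] {a b : α} (h : σ.SameCycle a b) :
    minimalPeriod σ a = minimalPeriod σ b := by
  obtain ⟨n, -, rfl⟩ := sameCycle_iff_exists_iterate.1 h
  exact (minimalPeriod_apply_iterate (mem_periodicPts_perm σ a) n).symm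

lemma Orbit.len_mk [Finite α] (a : α) : (mk σ a).len = minimalPeriod σ a :=
  minimalPeriod_eq_of_sameCycle (out_mk a)

lemma Orbit.len_pos [Finite α] (q : Orbit σ) : 0 < q.len :=
  minimalPeriod_pos_of_mem_periodicPts (mem_periodicPts_perm σ _)

variable [Fintype α]

lemma card_mk_eq (q : Orbit σ) : (Finset.univ.filter fun a => mk σ a = q).card = q.len := by
  rw [← Finset.card_range q.len]
  symm
  refine Finset.card_bij (fun n _ => σ^[n] q.out) (fun n _ => ?_) (fun m hm n hn h => ?_)
    fun a ha => ?_
  · have : σ.SameCycle (σ^[n] q.out) q.out :=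
      Equiv.Perm.SameCycle.symm ⟨n, by rw [zpow_natCast, Equiv.Perm.coe_pow]⟩
    simpa using (mk_eq_mk.2 this).trans (mk_out q)
  · exact iterate_injOn_Iio_minimalPeriod (Finset.mem_range.1 hm) (Finset.mem_range.1 hn) h
  · have h : σ.SameCycle q.out a :=
      mk_eq_mk.1 ((mk_out q).trans (Finset.mem_filter.1 ha).2.symm)
    obtain ⟨n, hn, rfl⟩ := sameCycle_iff_exists_iterate.1 h
    exact ⟨n, Finset.mem_range.2 hn, rfl⟩

variable [DecidableEq α]

lemma minimalPeriod_eq_card_support {a : α} (ha : a ∈ σ.support) :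
    minimalPeriod σ a = (σ.cycleOf a).support.card := by
  have ha' : σ a ≠ a := Equiv.Perm.mem_support.1 ha
  have hc : (σ.cycleOf a).IsCycle := Equiv.Perm.isCycle_cycleOf σ ha'
  rw [← hc.orderOf]
  refine Nat.dvd_right_iff_eq.1 fun n => ?_
  rw [← isPeriodicPt_iff_minimalPeriod_dvd, orderOf_dvd_iff_pow_eq_one, IsPeriodicPt, IsFixedPt,
    ← Equiv.Perm.coe_pow, ← Equiv.Perm.cycleOf_pow_apply_self]
  constructor
  · intro h
    exact hc.pow_eq_one_iff.2 ⟨a, by rwa [Equiv.Perm.cycleOf_apply_self], h⟩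
  · intro h
    rw [h, Equiv.Perm.one_apply]

lemma mul_count_parts (σ : Equiv.Perm α) (i : ℕ) :
    σ.partition.parts.count i * i = (Finset.univ.filter fun a => minimalPeriod σ a = i).card := by
  match i with
  | 0 =>
    rw [mul_zero, eq_comm, Finset.card_eq_zero, Finset.filter_eq_empty_iff]
    exact fun a _ => (minimalPeriod_pos_of_mem_periodicPts (mem_periodicPts_perm σ a)).ne'
  | 1 =>
    have h1 : σ.cycleType.count 1 = 0 := Multiset.count_eq_zero_of_notMem fun h =>
      absurd (Equiv.Perm.two_le_of_mem_cycleType h) (by norm_num)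
    rw [Equiv.Perm.parts_partition, Multiset.count_add, h1, Multiset.count_replicate_self,
      ← Finset.card_compl, zero_add, mul_one]
    congr 1
    ext a
    simp [minimalPeriod_eq_one_iff_isFixedPt, IsFixedPt]
  | i + 2 =>
    have hsupp {a : α} (ha : minimalPeriod σ a = i + 2) : a ∈ σ.support := by
      rw [Equiv.Perm.mem_support]
      intro h
      rw [minimalPeriod_eq_one_iff_isFixedPt.2 h] at ha
      omega
    rw [Equiv.Perm.parts_partition, Multiset.count_add, Multiset.count_replicate,
      if_neg (by omega), add_zero, Equiv.Perm.cycleType_def, Multiset.count_map,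
      ← Finset.filter_val, Finset.card_val, ← smul_eq_mul, ← Finset.sum_const,
      Finset.card_eq_sum_card_fiberwise (f := σ.cycleOf)
        (t := σ.cycleFactorsFinset.filter fun c => i + 2 = (Finset.card ∘ Equiv.Perm.support) c)]
    · refine Finset.sum_congr rfl fun c hc => ?_
      obtain ⟨hc, hci⟩ := Finset.mem_filter.1 hc
      rw [hci, comp_apply]
      congr 1
      ext a
      simp only [Finset.mem_filter, Finset.mem_univ, true_and]
      constructor
      · intro ha
        have hca := Equiv.Perm.cycle_is_cycleOf ha hc
        have ha' := Equiv.Perm.mem_cycleFactorsFinset_support_le hc ha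
        exact ⟨by rw [minimalPeriod_eq_card_support ha', hca], hca.symm⟩
      · rintro ⟨ha, rfl⟩
        rw [← comp_apply (f := Finset.card), ← hci] at ha
        exact Equiv.Perm.mem_support_cycleOf_iff.2 ⟨Equiv.Perm.SameCycle.refl _ _, hsupp ha⟩
    · intro a ha
      have ha : minimalPeriod σ a = i + 2 := by simpa using ha
      have := hsupp ha
      simp only [Finset.coe_filter, Set.mem_ofPred_eq, comp_apply]
      exact ⟨Equiv.Perm.cycleOf_mem_cycleFactorsFinset_iff.2 this,
        by rw [← minimalPeriod_eq_card_support this, ha]⟩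

lemma parts_partition_eq (σ : Equiv.Perm α) :
    σ.partition.parts = (Finset.univ : Finset (Orbit σ)).val.map len := by
  refine Multiset.ext.2 fun i => ?_
  obtain rfl | hi := Nat.eq_zero_or_pos i
  · rw [Multiset.count_eq_zero_of_notMem fun h => (σ.partition.parts_pos h).ne rfl,
      Multiset.count_eq_zero_of_notMem fun h => ?_]
    obtain ⟨q, -, hq⟩ := Multiset.mem_map.1 h
    exact q.len_pos.ne' hq
  · refine Nat.eq_of_mul_eq_mul_right hi ?_
    rw [mul_count_parts, Multiset.count_map, ← Finset.filter_val, Finset.card_val,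
      ← smul_eq_mul, ← Finset.sum_const,
      Finset.card_eq_sum_card_fiberwise (f := mk σ)
        (t := Finset.univ.filter fun q : Orbit σ => i = q.len)]
    · refine Finset.sum_congr rfl fun q hq => ?_
      rw [(Finset.mem_filter.1 hq).2, ← card_mk_eq q, Finset.filter_filter]
      congr 1
      ext a
      simp only [Finset.mem_filter, Finset.mem_univ, true_and, and_iff_right_iff_imp]
      rintro rfl
      rw [card_mk_eq, len_mk]
    · intro a ha
      simpa [len_mk, eq_comm] using ha

lemma prod_parts (σ : Equiv.Perm α) (f : ℕ → ℝ) :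
    (σ.partition.parts.map f).prod = ∏ q : Orbit σ, f q.len := by
  rw [parts_partition_eq, Multiset.map_map]
  rfl

/-! ### The cycles of an element of a wreath product -/

section Wreath

variable {β γ G : Type*} [Group G]

/-- The product of the entries of `g` at the first `m` points of the orbit of `b` under `h`, the
entry at `b` being the rightmost factor. -/
def cocycle (h : Equiv.Perm β) (g : β → G) : ℕ → β → G
  | 0, _ => 1
  | m + 1, b => cocycle h g m (h b) * g b

/-- The cycle product of `g` along a cycle `q` of `h`, starting at the chosen point of `q`. -/
def cycleProduct {h : Equiv.Perm β} (g : β → G) (q : Orbit h) : G := cocycle h g q.len q.out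

/-- The permutation of `β × γ` that lets `g b` act inside the block over `b` and then moves the
blocks by `h`. -/
def shearPerm (h : Equiv.Perm β) (g : β → Equiv.Perm γ) : Equiv.Perm (β × γ) := Equiv.prodShear h g

lemma iterate_shearPerm (h : Equiv.Perm β) (g : β → Equiv.Perm γ) (m : ℕ) (b : β) (x : γ) :
    (shearPerm h g)^[m] (b, x) = (h^[m] b, cocycle h g m b x) := by
  induction m generalizing b x with
  | zero => simp [cocycle]
  | succ m ih =>
    have hb : shearPerm h g (b, x) = (h b, g b x) := rfl
    rw [iterate_succ_apply, iterate_succ_apply, hb, ih]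
    rfl

lemma iterate_shearPerm_len_mul {h : Equiv.Perm β} (g : β → Equiv.Perm γ) (q : Orbit h) (j : ℕ)
    (x : γ) :
    (shearPerm h g)^[q.len * j] (q.out, x) =
      (q.out, (⇑(cycleProduct g q : Equiv.Perm γ))^[j] x) := by
  rw [iterate_mul]
  induction j generalizing x with
  | zero => rfl
  | succ j ih =>
    rw [iterate_succ_apply, iterate_succ_apply, iterate_shearPerm, len, iterate_minimalPeriod,
      ← len,
      ih]
    rfl

lemma minimalPeriod_shearPerm_out {h : Equiv.Perm β} (g : β → Equiv.Perm γ) (q : Orbit h) (x : γ) :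
    minimalPeriod (shearPerm h g) (q.out, x) =
      q.len * minimalPeriod (cycleProduct g q : Equiv.Perm γ) x := by
  refine Nat.dvd_right_iff_eq.1 fun n => ?_
  rw [← isPeriodicPt_iff_minimalPeriod_dvd]
  constructor
  · intro hn
    obtain ⟨j, rfl⟩ : q.len ∣ n := by
      refine isPeriodicPt_iff_minimalPeriod_dvd.1 ?_
      rw [IsPeriodicPt, IsFixedPt, iterate_shearPerm] at hn
      exact congrArg Prod.fst hn
    rw [IsPeriodicPt, IsFixedPt, iterate_shearPerm_len_mul] at hn
    exact mul_dvd_mul_left _ (isPeriodicPt_iff_minimalPeriod_dvd.1 (congrArg Prod.snd hn))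
  · rintro ⟨j, rfl⟩
    rw [IsPeriodicPt, IsFixedPt, mul_assoc, iterate_shearPerm_len_mul]
    exact congrArg (Prod.mk q.out)
      (isPeriodicPt_iff_minimalPeriod_dvd.2 (dvd_mul_right _ j) : IsPeriodicPt _ _ x)

variable [Finite β] [Finite γ]

lemma sameCycle_shearPerm_out {h : Equiv.Perm β} (g : β → Equiv.Perm γ)
    {q q' : Orbit h} {x x' : γ} :
    (shearPerm h g).SameCycle (q.out, x) (q'.out, x') ↔
      q = q' ∧ (cycleProduct g q).SameCycle x x' := by
  constructor
  · intro hs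
    obtain ⟨n, -, hn⟩ := sameCycle_iff_exists_iterate.1 hs
    rw [iterate_shearPerm] at hn
    have hq : q = q' := by
      rw [← mk_out q, ← mk_out q', mk_eq_mk]
      exact ⟨n, by rw [zpow_natCast, Equiv.Perm.coe_pow]; exact congrArg Prod.fst hn⟩
    subst hq
    obtain ⟨j, rfl⟩ : q.len ∣ n :=
      isPeriodicPt_iff_minimalPeriod_dvd.1 (congrArg Prod.fst hn)
    rw [← iterate_shearPerm, iterate_shearPerm_len_mul] at hn
    exact ⟨rfl, j, by rw [zpow_natCast, Equiv.Perm.coe_pow]; exact congrArg Prod.snd hn⟩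
  · rintro ⟨rfl, hs⟩
    obtain ⟨j, -, rfl⟩ := sameCycle_iff_exists_iterate.1 hs
    refine ⟨(q.len * j : ℕ), ?_⟩
    rw [zpow_natCast, Equiv.Perm.coe_pow, iterate_shearPerm_len_mul]

/-- The cycles of an element of a wreath product are the cycles of the cycle products along the
cycles of the permutation of the blocks. -/
lemma bijective_wreathOrbit {h : Equiv.Perm β} (g : β → Equiv.Perm γ) :
    Bijective fun p : (q : Orbit h) × Orbit (cycleProduct g q) =>
      mk (shearPerm h g) (p.1.out, p.2.out) := by
  constructor
  · rintro ⟨q, r⟩ ⟨q', r'⟩ hp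
    obtain ⟨rfl, hr⟩ := (sameCycle_shearPerm_out g).1 (mk_eq_mk.1 hp)
    rw [← mk_eq_mk, mk_out, mk_out] at hr
    exact congrArg (Sigma.mk q) hr
  · intro Q
    obtain ⟨⟨b, x⟩, rfl⟩ : ∃ a, Orbit.mk _ a = Q := ⟨_, mk_out Q⟩
    obtain ⟨n, -, hn⟩ := sameCycle_iff_exists_iterate.1 (out_mk (σ := h) b).symm
    set q := mk h b
    have h1 : (shearPerm h g).SameCycle (b, x) (q.out, cocycle h g n b x) :=
      ⟨n, by rw [zpow_natCast, Equiv.Perm.coe_pow, iterate_shearPerm, hn]⟩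
    refine ⟨⟨q, mk _ (cocycle h g n b x)⟩, mk_eq_mk.2 ?_⟩
    exact ((sameCycle_shearPerm_out g).2 ⟨rfl, out_mk _⟩).trans h1.symm

end Wreath

lemma prod_orbit_shearPerm {β γ : Type*} [Fintype β] [Fintype γ] (h : Equiv.Perm β)
    (g : β → Equiv.Perm γ) (f : ℕ → ℝ) :
    ∏ Q : Orbit (shearPerm h g), f Q.len =
      ∏ q : Orbit h, ∏ r : Orbit (cycleProduct g q), f (q.len * r.len) := by
  rw [Finset.prod_sigma', Finset.univ_sigma_univ]
  symm
  refine Fintype.prod_bijective _ (bijective_wreathOrbit g) _ _ fun p => ?_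
  rw [len_mk, minimalPeriod_shearPerm_out, len, len]

section CycleProductUniform

variable {β G : Type*} [Group G]

lemma cocycle_congr {h : Equiv.Perm β} {g g' : β → G} {m : ℕ} {b : β}
    (hg : ∀ j < m, g (h^[j] b) = g' (h^[j] b)) : cocycle h g m b = cocycle h g' m b := by
  induction m generalizing b with
  | zero => rfl
  | succ m ih =>
    rw [cocycle, cocycle, show g b = g' b from hg 0 (by omega)]
    exact congrArg (· * g' b) (ih fun j hj => hg (j + 1) (by omega))

variable [Fintype β] [DecidableEq β]

/-- Replace the entry of `g` at the chosen point of every cycle by the cycle product. -/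
def markedProducts (h : Equiv.Perm β) (g : β → G) (b : β) : G :=
  if b = (mk h b).out then cycleProduct g (mk h b) else g b

lemma markedProducts_injective (h : Equiv.Perm β) :
    Injective (markedProducts h : (β → G) → β → G) := by
  intro g g' hgg
  have hne {b : β} (hb : b ≠ (mk h b).out) : g b = g' b := by
    simpa [markedProducts, hb] using congrFun hgg b
  funext b
  by_cases hb : b = (mk h b).out
  · have hval := congrFun hgg b
    rw [markedProducts, markedProducts, if_pos hb, if_pos hb, cycleProduct, cycleProduct] at hval
    obtain ⟨m, hm⟩ := Nat.exists_eq_succ_of_ne_zero (mk h b).len_pos.ne'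
    rw [hm, ← hb, cocycle, cocycle] at hval
    -- The other points of the cycle are not chosen, so the entries there agree.
    have hrest : cocycle h g m (h b) = cocycle h g' m (h b) := by
      refine cocycle_congr fun j hj => hne fun hj' => ?_
      have hsame : mk h (h^[j] (h b)) = mk h b := by
        rw [mk_eq_mk]
        refine Equiv.Perm.SameCycle.symm ⟨(j + 1 : ℕ), ?_⟩
        rw [zpow_natCast, Equiv.Perm.coe_pow, iterate_succ_apply]
      rw [hsame, ← hb, ← iterate_succ_apply h] at hj'
      have hdvd := isPeriodicPt_iff_minimalPeriod_dvd.1 (hj' : IsPeriodicPt h (j + 1) b)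
      rw [← len_mk, hm] at hdvd
      have := Nat.le_of_dvd (by omega) hdvd
      omega
    rw [hrest] at hval
    exact mul_left_cancel hval
  · exact hne hb

/-- For a uniformly distributed `g`, the cycle products are independent and uniformly
distributed. -/
lemma sum_prod_cycleProduct [Fintype G] (h : Equiv.Perm β) (F : Orbit h → G → ℝ) :
    ∑ g : β → G, ∏ q : Orbit h, F q (cycleProduct g q) =
      (Fintype.card G : ℝ) ^ Fintype.card β *
        ∏ q : Orbit h, ((∑ p, F q p) / (Fintype.card G : ℝ)) := by
  have hG : (Fintype.card G : ℝ) ≠ 0 := by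
    have := Fintype.card_pos (α := G)
    positivity
  -- A product over the cycles is the product over their chosen points.
  have hout (u : Orbit h → β → ℝ) : ∏ q : Orbit h, u q q.out =
      ∏ b, if b = (mk h b).out then u (mk h b) b else 1 := by
    rw [← Finset.prod_filter]
    refine Finset.prod_bij (fun q _ => q.out) (fun q _ => by simp) (fun q _ q' _ hqq => ?_)
      (fun b hb => ⟨mk h b, Finset.mem_univ _, (Finset.mem_filter.1 hb).2.symm⟩) fun q _ => by simp
    rw [← mk_out q, hqq, mk_out]
  have hmark (g : β → G) (q : Orbit h) : cycleProduct g q = markedProducts h g q.out := by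
    rw [markedProducts, mk_out, if_pos rfl]
  simp only [hmark]
  rw [(Fintype.bijective_iff_injective_and_card _).2 ⟨markedProducts_injective h, rfl⟩ |>.sum_comp
    (fun g' : β → G => ∏ q : Orbit h, F q (g' q.out))]
  have hF (g' : β → G) : ∏ q : Orbit h, F q (g' q.out) =
      ∏ b, if b = (mk h b).out then F (mk h b) (g' b) else 1 := hout fun q b => F q (g' b)
  simp only [hF]
  rw [hout fun q _ => (∑ p, F q p) / (Fintype.card G : ℝ), ← Fintype.piFinset_univ,
    ← Finset.prod_univ_sum (fun _ => Finset.univ)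
      (fun b p => if b = (mk h b).out then F (mk h b) p else 1), ← Finset.card_univ (α := β),
    ← Finset.prod_const, ← Finset.prod_mul_distrib]
  refine Finset.prod_congr rfl fun b _ => ?_
  split_ifs
  · rw [mul_div_cancel₀ _ hG]
  · simp

end CycleProductUniform

end WreathCycles

namespace WreathCycles

open Topology

/-! ### The generating function of the cycle counts in a wreath product -/

lemma sum_prod_parts_shearPerm {β γ : Type*} [Fintype β] [DecidableEq β] [Fintype γ]
    [DecidableEq γ] (f : ℕ → ℝ) :
    ∑ p : (β → Equiv.Perm γ) × Equiv.Perm β, ((shearPerm p.2 p.1).partition.parts.map f).prod =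
      ((Fintype.card γ).factorial : ℝ) ^ Fintype.card β * (Fintype.card β).factorial *
        cycleIndex (fun l => cycleIndex (fun j => f (l * j)) (Fintype.card γ)) (Fintype.card β) := by
  have hγ : ((Fintype.card γ).factorial : ℝ) ≠ 0 := by positivity
  have hinner (h : Equiv.Perm β) :
      ∑ g : β → Equiv.Perm γ, ((shearPerm h g).partition.parts.map f).prod =
        ((Fintype.card γ).factorial : ℝ) ^ Fintype.card β * (h.partition.parts.map fun l =>
          cycleIndex (fun j => f (l * j)) (Fintype.card γ)).prod := by
    have horb (q : Orbit h) : (∑ p : Equiv.Perm γ, ∏ r : Orbit p, f (q.len * r.len)) /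
        (Fintype.card (Equiv.Perm γ) : ℝ) =
          cycleIndex (fun j => f (q.len * j)) (Fintype.card γ) := by
      simp only [← prod_parts _ fun j => f (q.len * j)]
      rw [sum_perm_prod_parts, Fintype.card_perm, mul_div_cancel_left₀ _ hγ]
    simp only [prod_parts, prod_orbit_shearPerm]
    rw [sum_prod_cycleProduct h fun q p => ∏ r : Orbit p, f (q.len * r.len)]
    simp only [horb]
    rw [Fintype.card_perm]
  rw [Fintype.sum_prod_type_right]
  simp only [hinner]
  rw [← Finset.mul_sum, sum_perm_prod_parts, mul_assoc]

lemma bijective_blockPerm {k n : ℕ} (hk : 0 < k) :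
    Function.Bijective fun p : (Fin n → Equiv.Perm (Fin k)) × Equiv.Perm (Fin n) =>
      (⟨blockPerm p.1 p.2, p.1, p.2, rfl⟩ : wreathSubgroup k n) := by
  constructor
  · rintro ⟨g, h⟩ ⟨g', h'⟩ heq
    have heq (b : Fin n) (x : Fin k) : (h b, g b x) = (h' b, g' b x) :=
      congrArg (fun σ : wreathSubgroup k n => σ.1 (b, x)) heq
    refine Prod.ext (funext fun b => Equiv.ext fun x => (Prod.ext_iff.1 (heq b x)).2)
      (Equiv.ext fun b => (Prod.ext_iff.1 (heq b ⟨0, hk⟩)).1)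
  · rintro ⟨_, g, h, rfl⟩
    exact ⟨(g, h), rfl⟩

lemma integral_uniformOn_univ {Ω : Type*} [Fintype Ω] [MeasurableSpace Ω]
    [MeasurableSingletonClass Ω] (F : Ω → ℝ) :
    ∫ ω, F ω ∂uniformOn (Set.univ : Set Ω) = (∑ ω, F ω) / Fintype.card Ω := by
  rw [integral_fintype .of_finite, Finset.sum_div]
  refine Finset.sum_congr rfl fun ω _ => ?_
  rw [Measure.real, uniformOn_univ, Measure.count_singleton]
  simp [div_eq_inv_mul]

instance (k n : ℕ) : MeasurableSingletonClass (wreathSubgroup k n) := ⟨fun _ => trivial⟩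

theorem integral_prod_parts_wreathSubgroup {k n : ℕ} (hk : 0 < k) (f : ℕ → ℝ) :
    ∫ σ : wreathSubgroup k n, (σ.1.partition.parts.map f).prod ∂uniformOn Set.univ =
      cycleIndex (fun l => cycleIndex (fun j => f (l * j)) k) n := by
  let _ : Fintype (wreathSubgroup k n) := Fintype.ofFinite _
  have hbij := bijective_blockPerm (n := n) hk
  rw [integral_uniformOn_univ, ← hbij.sum_comp, ← Fintype.card_of_bijective hbij]
  have hk0 : (k.factorial : ℝ) ≠ 0 := by positivity
  have hn0 : (n.factorial : ℝ) ≠ 0 := by positivity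
  have hsum : ∑ p : (Fin n → Equiv.Perm (Fin k)) × Equiv.Perm (Fin n),
      ((blockPerm p.1 p.2).partition.parts.map f).prod = (k.factorial : ℝ) ^ n * n.factorial *
        cycleIndex (fun l => cycleIndex (fun j => f (l * j)) k) n := by
    convert! sum_prod_parts_shearPerm (β := Fin n) (γ := Fin k) f <;> simp
  have hcard : (Fintype.card ((Fin n → Equiv.Perm (Fin k)) × Equiv.Perm (Fin n)) : ℝ) =
      (k.factorial : ℝ) ^ n * n.factorial := by
    simp [Fintype.card_perm]
  rw [hcard, hsum, mul_div_cancel_left₀ _ (by positivity)]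

/-- The limit of the generating function of the cycle counts of a uniformly distributed element of
the wreath product, as the size `k` and the number `n` of the blocks tend to infinity. -/
theorem tendsto_integral_prod_parts {f : ℕ → ℝ} (hf : ∀ i, f i ∈ Set.Icc (0 : ℝ) 1) {b : ℕ}
    (hfb : ∀ i, b < i → f i = 1) :
    Tendsto (fun p : ℕ × ℕ => ∫ σ : wreathSubgroup p.1 p.2, (σ.1.partition.parts.map f).prod
        ∂uniformOn Set.univ) (atTop ×ˢ atTop)
      (𝓝 (Real.exp (∑ l ∈ Finset.Icc 1 b,
        (Real.exp (∑ j ∈ Finset.Icc 1 b, (f (l * j) - 1) / j) - 1) / l))) := by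
  have hmul {l j : ℕ} (hj : 0 < j) (hl : b < l) : f (l * j) = 1 :=
    hfb _ (hl.trans_le (Nat.le_mul_of_pos_right l hj))
  have hy (k l : ℕ) : cycleIndex (fun j => f (l * j)) k ∈ Set.Icc (0 : ℝ) 1 := by
    refine ⟨cycleIndex_nonneg (fun j => (hf _).1) k, ?_⟩
    rw [← cycleIndex_const_one k]
    exact (le_abs_self _).trans (abs_cycleIndex_le (fun j => by
      rw [abs_of_nonneg (hf _).1]; exact (hf _).2) k)
  have hmain : Tendsto (fun p : ℕ × ℕ => cycleIndex (fun l => cycleIndex (fun j => f (l * j)) p.1)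
      p.2) (atTop ×ˢ atTop) (𝓝 (Real.exp (∑ l ∈ Finset.Icc 1 b,
        (Real.exp (∑ j ∈ Finset.Icc 1 b, (f (l * j) - 1) / j) - 1) / l))) := by
    refine tendsto_cycleIndex_atTop tendsto_snd (fun p l => hy p.1 l) (fun p l hl => ?_)
      fun l hl => ?_
    · rw [← cycleIndex_const_one p.1]
      exact cycleIndex_congr (fun j hj => hmul hj hl) p.1
    · exact tendsto_cycleIndex_atTop (y := fun (p : ℕ × ℕ) j => f (l * j)) tendsto_fst
        (fun _ _ => hf _) (fun _ j hj => by rw [mul_comm]; exact hmul hl hj)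
        fun _ _ => tendsto_const_nhds
  refine hmain.congr' ?_
  filter_upwards [tendsto_fst.eventually (eventually_gt_atTop 0)] with p hp
  exact (integral_prod_parts_wreathSubgroup hp f).symm

/-- The function `f` on cycle lengths for which `∏ x i ^ (number of cycles of length i)` is the
product of `f` over the lengths of all cycles. -/
def lengthWeight (s : Finset ℕ+) (x : ℕ+ → ℝ) (i : ℕ) : ℝ :=
  ∏ j ∈ s.filter fun j : ℕ+ => (j : ℕ) = i, x j

lemma prod_map_lengthWeight (s : Finset ℕ+) (x : ℕ+ → ℝ) (m : Multiset ℕ) :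
    (m.map (lengthWeight s x)).prod = ∏ i ∈ s, x i ^ m.count (i : ℕ) := by
  induction m using Multiset.induction_on with
  | empty => simp
  | cons a m ih =>
    rw [Multiset.map_cons, Multiset.prod_cons, ih, lengthWeight, Finset.prod_filter,
      ← Finset.prod_mul_distrib]
    refine Finset.prod_congr rfl fun i _ => ?_
    rw [Multiset.count_cons, pow_add, mul_comm]
    split_ifs <;> simp

lemma lengthWeight_mem_Icc {s : Finset ℕ+} {x : ℕ+ → ℝ} (hx : ∀ i, x i ∈ Set.Icc (0 : ℝ) 1)
    (i : ℕ) : lengthWeight s x i ∈ Set.Icc (0 : ℝ) 1 :=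
  ⟨Finset.prod_nonneg fun j _ => (hx j).1,
    Finset.prod_le_one (fun j _ => (hx j).1) fun j _ => (hx j).2⟩

lemma lengthWeight_eq_one {s : Finset ℕ+} {x : ℕ+ → ℝ} {i : ℕ} (hi : (s.sup fun j => (j : ℕ)) < i) :
    lengthWeight s x i = 1 := by
  refine Finset.prod_eq_one fun j hj => ?_
  obtain ⟨hjs, rfl⟩ := Finset.mem_filter.1 hj
  exact absurd (Finset.le_sup (f := fun j : ℕ+ => (j : ℕ)) hjs) (not_le.2 hi)

end WreathCycles

namespace WreathCycles

/-! ### Independence in the limiting space -/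

section Independence

variable {Ω ι κ E : Type*} [MeasurableSpace Ω] [MeasurableSpace E] {P : Measure Ω}

/-- Grouping an independent family indexed by pairs gives independent subfamilies. -/
lemma iIndepFun_curry {Z : ι × κ → Ω → E} (hm : ∀ p, Measurable (Z p)) (hZ : iIndepFun Z P) :
    iIndepFun (fun i ω k => Z (i, k) ω) P := by
  have := hZ.isProbabilityMeasure
  have (p : ι × κ) : IsProbabilityMeasure (P.map (Z p)) :=
    Measure.isProbabilityMeasure_map (hm p).aemeasurable
  have hmi (i : ι) : Measurable fun ω k => Z (i, k) ω := measurable_pi_iff.2 fun k => hm (i, k)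
  have hmarg (i : ι) : P.map (fun ω k => Z (i, k) ω) =
      Measure.infinitePi fun k => P.map (Z (i, k)) :=
    (hZ.precomp (g := fun k => (i, k)) fun _ _ h => (Prod.ext_iff.1 h).2).map_fun_eq_infinitePi_map
      fun k => hm (i, k)
  rw [iIndepFun_iff_map_fun_eq_infinitePi_map hmi]
  simp only [hmarg]
  rw [← Measure.infinitePi_map_curry (fun i k => P.map (Z (i, k))),
    ← hZ.map_fun_eq_infinitePi_map hm, Measure.map_map (by fun_prop) (measurable_pi_iff.2 hm)]
  rfl

/-- The coordinates of a product of two product measures are independent. -/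
lemma iIndepFun_sumElim {μ : ι → Measure E} {ν : κ → Measure E} [∀ i, IsProbabilityMeasure (μ i)]
    [∀ k, IsProbabilityMeasure (ν k)] :
    iIndepFun (fun (s : ι ⊕ κ) (ω : (ι → E) × (κ → E)) => Sum.elim ω.1 ω.2 s)
      ((Measure.infinitePi μ).prod (Measure.infinitePi ν)) := by
  have hm (s : ι ⊕ κ) : Measurable fun ω : (ι → E) × (κ → E) => Sum.elim ω.1 ω.2 s := by
    cases s <;> simp only [Sum.elim_inl, Sum.elim_inr] <;> fun_prop
  have hl (i : ι) : ((Measure.infinitePi μ).prod (Measure.infinitePi ν)).map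
      (fun ω => Sum.elim ω.1 ω.2 (Sum.inl i)) = μ i :=
    ((measurePreserving_eval_infinitePi μ i).comp measurePreserving_fst).map_eq
  have hr (k : κ) : ((Measure.infinitePi μ).prod (Measure.infinitePi ν)).map
      (fun ω => Sum.elim ω.1 ω.2 (Sum.inr k)) = ν k :=
    ((measurePreserving_eval_infinitePi ν k).comp measurePreserving_snd).map_eq
  have (s : ι ⊕ κ) : IsProbabilityMeasure (((Measure.infinitePi μ).prod
      (Measure.infinitePi ν)).map (fun ω => Sum.elim ω.1 ω.2 s)) :=
    Measure.isProbabilityMeasure_map (hm s).aemeasurable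
  rw [iIndepFun_iff_map_fun_eq_infinitePi_map hm]
  refine Measure.eq_infinitePi _ fun s t ht => ?_
  rw [Measure.map_apply (measurable_pi_iff.2 hm)
    (MeasurableSet.pi s.countable_toSet fun i _ => ht i)]
  have hset : (fun (ω : (ι → E) × (κ → E)) s => Sum.elim ω.1 ω.2 s) ⁻¹' (s : Set (ι ⊕ κ)).pi t =
      ((s.toLeft : Set ι).pi fun i => t (Sum.inl i)) ×ˢ
        ((s.toRight : Set κ).pi fun k => t (Sum.inr k)) := by
    ext ω
    simp [Set.mem_pi]
  rw [hset, Measure.prod_prod, Measure.infinitePi_pi _ fun i _ => ht _,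
    Measure.infinitePi_pi _ fun k _ => ht _]
  conv_rhs => rw [← Finset.toLeft_disjSum_toRight (u := s), Finset.prod_disjSum]
  simp only [hl, hr]

/-- A finite product of functions of independent variables. -/
lemma integral_finset_prod_comp {𝓧 : ι → Type*} [∀ i, MeasurableSpace (𝓧 i)]
    {Z : (i : ι) → Ω → 𝓧 i} (hZ : iIndepFun Z P) (hm : ∀ i, Measurable (Z i)) (s : Finset ι)
    {f : (i : ι) → 𝓧 i → ℝ} (hf : ∀ i, Measurable (f i)) :
    ∫ ω, ∏ i ∈ s, f i (Z i ω) ∂P = ∏ i ∈ s, ∫ ω, f i (Z i ω) ∂P := by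
  have h := iIndepFun.integral_fun_prod_comp (X := fun i : s => Z i) (f := fun i : s => f i)
    (hZ.precomp (g := ((↑) : s → ι)) Subtype.val_injective)
    (fun i => (hm i).aemeasurable) (fun i => (hf i).aestronglyMeasurable)
  rw [← Finset.prod_coe_sort s fun i => ∫ ω, f i (Z i ω) ∂P]
  simp only [← Finset.prod_coe_sort s fun i => f i (Z i _)]
  exact h

end Independence

/-- The law of the sequence `(Y (l, m, k))_k`, for fixed `l` and `m`: independent Poisson variables
with parameters `1 / k`. -/
def markMeasure : Measure (ℕ → ℕ) := Measure.infinitePi fun k : ℕ => poissonMeasure (1 / (k : ℝ≥0))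

instance : IsProbabilityMeasure markMeasure := by
  unfold markMeasure
  infer_instance

/-- The sequence `(Y (l, m, k))_k`, the mark of the `m`-th cycle of length `l`. -/
def mark (l m : ℕ) (y : ℕ × ℕ × ℕ → ℕ) (k : ℕ) : ℕ := y (l, m, k)

lemma measurable_mark (l m : ℕ) : Measurable (mark l m) :=
  measurable_pi_iff.2 fun _ => measurable_pi_apply _

lemma measurable_mark_snd (l m : ℕ) : Measurable fun ω : LimitSpace => mark l m ω.2 :=
  (measurable_mark l m).comp measurable_snd

/-- The joint law of the coordinates `Y`. -/
def marksMeasure : Measure (ℕ × ℕ × ℕ → ℕ) :=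
  Measure.infinitePi fun q : ℕ × ℕ × ℕ => poissonMeasure (1 / (q.2.2 : ℝ≥0))

instance : IsProbabilityMeasure marksMeasure := by
  unfold marksMeasure
  infer_instance

/-- The joint law of the coordinates `N`. -/
def countsMeasure : Measure (ℕ → ℕ) :=
  Measure.infinitePi fun l : ℕ => poissonMeasure (1 / (l : ℝ≥0))

instance : IsProbabilityMeasure countsMeasure := by
  unfold countsMeasure
  infer_instance

lemma limitMeasure_eq_prod : limitMeasure = countsMeasure.prod marksMeasure := rfl

lemma iIndepFun_coord : iIndepFun (fun (q : ℕ × ℕ × ℕ) (y : ℕ × ℕ × ℕ → ℕ) => y q) marksMeasure :=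
  iIndepFun_infinitePi (X := fun _ => id) fun _ => measurable_id

lemma map_mark (l m : ℕ) : marksMeasure.map (mark l m) = markMeasure := by
  have h := (iIndepFun_coord.precomp (g := fun k => (l, m, k))
    fun _ _ h => (Prod.ext_iff.1 (Prod.ext_iff.1 h).2).2).map_fun_eq_infinitePi_map
      fun k => measurable_pi_apply _
  refine h.trans ?_
  refine congrArg Measure.infinitePi (funext fun k => ?_)
  exact (measurePreserving_eval_infinitePi
    (fun q : ℕ × ℕ × ℕ => poissonMeasure (1 / (q.2.2 : ℝ≥0))) (l, m, k)).map_eq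

lemma iIndepFun_mark : iIndepFun (fun (p : ℕ × ℕ) => mark p.1 p.2) marksMeasure := by
  have h := iIndepFun_coord.precomp (g := fun q : (ℕ × ℕ) × ℕ => (q.1.1, q.1.2, q.2))
    fun a b h => by simpa [Prod.ext_iff, and_assoc] using h
  exact iIndepFun_curry (fun q => measurable_pi_apply (q.1.1, q.1.2, q.2)) h

lemma integral_mark (l m : ℕ) {f : (ℕ → ℕ) → ℝ} (hf : Measurable f) :
    ∫ y, f (mark l m y) ∂marksMeasure = ∫ y, f y ∂markMeasure := by
  rw [← map_mark l m, integral_map (measurable_mark l m).aemeasurable hf.aestronglyMeasurable]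

/-- The family of all the coordinates of the limiting space belonging to the cycles of length
`l`. -/
def levelCoord (l : ℕ) (ω : LimitSpace) : Option (ℕ × ℕ) → ℕ
  | none => ω.1 l
  | some (m, k) => ω.2 (l, m, k)

lemma measurable_levelCoord (l : ℕ) : Measurable (levelCoord l) := by
  refine measurable_pi_iff.2 fun o => ?_
  rcases o with _ | ⟨m, k⟩ <;> simp only [levelCoord] <;> fun_prop

lemma iIndepFun_levelCoord : iIndepFun levelCoord limitMeasure := by
  let e : ℕ × Option (ℕ × ℕ) → ℕ ⊕ (ℕ × ℕ × ℕ) :=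
    fun p => p.2.elim (Sum.inl p.1) fun q => Sum.inr (p.1, q)
  have he : Function.Injective e := by
    rintro ⟨l, _ | q⟩ ⟨l', _ | q'⟩ h <;> simp_all [e]
  have hcoord : iIndepFun (fun (s : ℕ ⊕ (ℕ × ℕ × ℕ)) (ω : LimitSpace) => Sum.elim ω.1 ω.2 s)
      limitMeasure := iIndepFun_sumElim
  have h := iIndepFun_curry (Z := fun p (ω : LimitSpace) => Sum.elim ω.1 ω.2 (e p)) (fun p => by
    rcases p with ⟨l, _ | q⟩ <;> simp only [e, Option.elim, Sum.elim_inl, Sum.elim_inr] <;>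
      fun_prop)
    (hcoord.precomp he)
  convert! h using 2 with l
  ext ω o
  rcases o with _ | ⟨m, k⟩ <;> rfl

/-! ### Compound Poisson generating functions -/

lemma measurable_prod_range {Ω : Type*} [MeasurableSpace Ω] {N : Ω → ℕ} (hN : Measurable N)
    {F : ℕ → Ω → ℝ} (hF : ∀ m, Measurable (F m)) :
    Measurable fun ω => ∏ m ∈ Finset.range (N ω), F m ω := by
  have h : Measurable fun p : ℕ × Ω => ∏ m ∈ Finset.range p.1, F m p.2 :=
    measurable_from_prod_countable_right fun n => by
      dsimp only
      exact Finset.measurable_fun_prod _ fun m _ => hF m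
  exact h.comp (hN.prodMk measurable_id)

/-- If the `m`-th cycle of length `l` contributes the factor `ψ l`, evaluated at its mark, then the
expected product of all the contributions is that of compound Poisson variables. -/
theorem integral_prod_prod_mark (s : Finset ℕ) {ψ : ℕ → (ℕ → ℕ) → ℝ} (hψ : ∀ l, Measurable (ψ l))
    (hψ01 : ∀ l y, ψ l y ∈ Set.Icc (0 : ℝ) 1) :
    ∫ ω, ∏ l ∈ s, ∏ m ∈ Finset.range (ω.1 l), ψ l (mark l m ω.2) ∂limitMeasure =
      Real.exp (∑ l ∈ s, (∫ y, ψ l y ∂markMeasure - 1) / l) := by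
  have hmeas : Measurable fun ω : LimitSpace =>
      ∏ l ∈ s, ∏ m ∈ Finset.range (ω.1 l), ψ l (mark l m ω.2) :=
    Finset.measurable_fun_prod _ fun l _ => measurable_prod_range
      ((measurable_pi_apply l).comp measurable_fst)
      fun m => (hψ l).comp (measurable_mark_snd l m)
  have hint : Integrable (fun ω : LimitSpace =>
      ∏ l ∈ s, ∏ m ∈ Finset.range (ω.1 l), ψ l (mark l m ω.2)) limitMeasure := by
    refine Integrable.of_bound hmeas.aestronglyMeasurable 1 (ae_of_all _ fun ω => ?_)
    rw [Real.norm_of_nonneg (Finset.prod_nonneg fun l _ =>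
      Finset.prod_nonneg fun m _ => (hψ01 l _).1)]
    exact Finset.prod_le_one (fun l _ => Finset.prod_nonneg fun m _ => (hψ01 l _).1)
      fun l _ => Finset.prod_le_one (fun m _ => (hψ01 l _).1) fun m _ => (hψ01 l _).2
  rw [limitMeasure_eq_prod] at hint ⊢
  rw [integral_prod _ hint]
  have hinner (N : ℕ → ℕ) : ∫ y, ∏ l ∈ s, ∏ m ∈ Finset.range (N l), ψ l (mark l m y) ∂marksMeasure =
      ∏ l ∈ s, (∫ y, ψ l y ∂markMeasure) ^ N l := by
    have hpairs (F : ℕ × ℕ → ℝ) : ∏ l ∈ s, ∏ m ∈ Finset.range (N l), F (l, m) =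
        ∏ p ∈ (s.sigma fun l => Finset.range (N l)).map (Equiv.sigmaEquivProd ℕ ℕ).toEmbedding,
          F p := by
      rw [Finset.prod_map, Finset.prod_sigma]
      rfl
    have h1 (y : ℕ × ℕ × ℕ → ℕ) := hpairs fun p => ψ p.1 (mark p.1 p.2 y)
    dsimp only at h1
    simp only [h1]
    rw [integral_finset_prod_comp iIndepFun_mark (fun p => measurable_mark p.1 p.2) _
      (f := fun p => ψ p.1) fun p => hψ p.1,
      ← hpairs fun p => ∫ y, ψ p.1 (mark p.1 p.2 y) ∂marksMeasure]
    simp only [integral_mark _ _ (hψ _), Finset.prod_const, Finset.card_range]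
  simp only [hinner]
  have hN : iIndepFun (fun (l : ℕ) (N : ℕ → ℕ) => N l) countsMeasure :=
    iIndepFun_infinitePi (X := fun _ => id) fun _ => measurable_id
  rw [integral_finset_prod_comp hN (fun l => measurable_pi_apply l) s
    (f := fun l n => (∫ y, ψ l y ∂markMeasure) ^ n) (fun l => .of_discrete), Real.exp_sum]
  refine Finset.prod_congr rfl fun l _ => ?_
  have hl :=
    (measurePreserving_eval_infinitePi (fun l : ℕ => poissonMeasure (1 / (l : ℝ≥0))) l).map_eq
  have h2 := integral_map (μ := countsMeasure) (φ := fun N : ℕ → ℕ => N l)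
    (measurable_pi_apply l).aemeasurable
    (f := fun n : ℕ => (∫ y, ψ l y ∂markMeasure) ^ n) .of_discrete
  rw [← h2]
  refine (congrArg (fun ρ => ∫ n : ℕ, (∫ y, ψ l y ∂markMeasure) ^ n ∂ρ) hl).trans ?_
  rw [integral_pow_poissonMeasure]
  congr 1
  push_cast
  ring

end WreathCycles

namespace WreathCycles

/-! ### The joint law of the variables `X` -/

/-- `X` as a function of the coordinates belonging to the cycles of length `l`. -/
def levelX (k j : ℕ) (c : Option (ℕ × ℕ) → ℕ) : ℕ :=
  ((Finset.range (c none)).filter fun m => c (some (m, k)) = j).card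

lemma measurable_levelX (k j : ℕ) : Measurable (levelX k j) := by
  have h : Measurable fun p : ℕ × (Option (ℕ × ℕ) → ℕ) =>
      ((Finset.range p.1).filter fun m => p.2 (some (m, k)) = j).card :=
    measurable_from_prod_countable_right fun n => by
      simp only [Finset.card_filter]
      exact Finset.measurable_fun_sum _ fun m _ => Measurable.ite
        (measurableSet_eq_fun (measurable_pi_apply (some (m, k))) measurable_const)
        measurable_const measurable_const
  have hc : Measurable fun c : Option (ℕ × ℕ) → ℕ => (c none, c) :=
    (measurable_pi_apply none).prodMk measurable_id
  exact h.comp hc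

lemma measurable_X (l k j : ℕ) : Measurable (X l k j) :=
  (measurable_levelX k j).comp (measurable_levelCoord l)

lemma iIndepFun_X_families :
    iIndepFun (fun (l : ℕ) (ω : LimitSpace) (q : ℕ × ℕ) => X l q.1 q.2 ω) limitMeasure :=
  iIndepFun_levelCoord.comp (fun _ c (q : ℕ × ℕ) => levelX q.1 q.2 c)
    fun _ => measurable_pi_iff.2 fun q => measurable_levelX q.1 q.2

lemma integral_markMeasure_eval (k : ℕ) (f : ℕ → ℝ) :
    ∫ y, f (y k) ∂markMeasure = ∫ n, f n ∂poissonMeasure (1 / (k : ℝ≥0)) := by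
  rw [← (measurePreserving_eval_infinitePi (fun k : ℕ => poissonMeasure (1 / (k : ℝ≥0))) k).map_eq,
    integral_map (measurable_pi_apply k).aemeasurable .of_discrete]
  rfl

/-- The factor contributed to the joint generating function of the `X l k j`, for fixed `l` and `k`,
by a cycle of length `l` with `n` attached cycles of length `k`. -/
def pointWeight (s : Finset (ℕ × ℕ)) (x : ℕ × ℕ → ℝ) (l n : ℕ) : ℝ :=
  ∏ p ∈ s with p.1 = l, if n = p.2 then x p else 1

lemma pointWeight_eq_one_add (s : Finset (ℕ × ℕ)) (x : ℕ × ℕ → ℝ) (l n : ℕ) :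
    pointWeight s x l n = 1 + ∑ p ∈ s with p.1 = l, if n = p.2 then x p - 1 else 0 := by
  have hiff {p : ℕ × ℕ} (hp : p ∈ s.filter fun p => p.1 = l) : n = p.2 ↔ (l, n) = p := by
    obtain ⟨-, rfl⟩ := Finset.mem_filter.1 hp
    simp [Prod.ext_iff]
  rw [pointWeight, Finset.prod_congr rfl fun p hp => if_congr (hiff hp) rfl rfl,
    Finset.sum_congr rfl fun p hp => if_congr (hiff hp) rfl rfl, Finset.prod_ite_eq,
    Finset.sum_ite_eq]
  split_ifs <;> ring

lemma pointWeight_mem_Icc {s : Finset (ℕ × ℕ)} {x : ℕ × ℕ → ℝ}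
    (hx : ∀ p, x p ∈ Set.Icc (0 : ℝ) 1) (l n : ℕ) : pointWeight s x l n ∈ Set.Icc (0 : ℝ) 1 := by
  have h (p : ℕ × ℕ) : (if n = p.2 then x p else 1) ∈ Set.Icc (0 : ℝ) 1 := by
    split_ifs
    · exact hx p
    · simp
  exact ⟨Finset.prod_nonneg fun p _ => (h p).1,
    Finset.prod_le_one (fun p _ => (h p).1) fun p _ => (h p).2⟩

lemma integral_pointWeight (s : Finset (ℕ × ℕ)) (x : ℕ × ℕ → ℝ) (l k : ℕ) :
    ∫ y, pointWeight s x l (y k) ∂markMeasure =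
      1 + ∑ p ∈ s with p.1 = l, (poissonMass k p.2 : ℝ) * (x p - 1) := by
  have hind (j : ℕ) (c : ℝ) : (fun n : ℕ => if n = j then c else 0) =
      ({j} : Set ℕ).indicator fun _ => c := by
    funext n
    simp [Set.indicator_apply]
  have hint (j : ℕ) (c : ℝ) : Integrable (fun n : ℕ => if n = j then c else 0)
      (poissonMeasure (1 / (k : ℝ≥0))) := by
    rw [hind]
    exact (integrable_const c).indicator (measurableSet_singleton j)
  rw [integral_markMeasure_eval k (pointWeight s x l)]
  simp only [pointWeight_eq_one_add]
  rw [integral_add (integrable_const _) (integrable_finsetSum _ fun p _ => hint _ _),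
    integral_finsetSum _ fun p _ => hint _ _]
  simp only [hind, integral_indicator_const _ (measurableSet_singleton _), smul_eq_mul]
  simp [poissonMass, Measure.real, ENNReal.toReal]

lemma prod_pow_X (κ : ℕ → ℕ) (s : Finset (ℕ × ℕ)) (x : ℕ × ℕ → ℝ) (ω : LimitSpace) :
    ∏ p ∈ s, x p ^ X p.1 (κ p.1) p.2 ω =
      ∏ l ∈ s.image Prod.fst, ∏ m ∈ Finset.range (ω.1 l),
        pointWeight s x l (mark l m ω.2 (κ l)) := by
  rw [← Finset.prod_fiberwise_of_maps_to (g := Prod.fst) (t := s.image Prod.fst)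
    fun p hp => Finset.mem_image_of_mem _ hp]
  refine Finset.prod_congr rfl fun l _ => ?_
  simp only [pointWeight]
  rw [Finset.prod_comm]
  refine Finset.prod_congr rfl fun p hp => ?_
  obtain ⟨-, rfl⟩ := Finset.mem_filter.1 hp
  rw [X, ← Finset.prod_const, Finset.prod_filter]
  rfl

/-- For one index `k = κ l` for each `l`, the variables `X l k j` are independent Poisson
variables. -/
theorem map_X_eq_infinitePi (κ : ℕ → ℕ) :
    limitMeasure.map (fun ω (p : ℕ × ℕ) => X p.1 (κ p.1) p.2 ω) =
      Measure.infinitePi fun p : ℕ × ℕ =>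
        poissonMeasure (poissonMass (κ p.1) p.2 / (p.1 : ℝ≥0)) := by
  have hm : Measurable fun ω (p : ℕ × ℕ) => X p.1 (κ p.1) p.2 ω :=
    measurable_pi_iff.2 fun p => measurable_X _ _ _
  have := Measure.isProbabilityMeasure_map (μ := limitMeasure) hm.aemeasurable
  refine ext_of_pgf fun s x hx => ?_
  have hmono : Measurable fun c : ℕ × ℕ → ℕ => ∏ p ∈ s, x p ^ c p :=
    Finset.measurable_fun_prod _ fun p _ =>
      (Measurable.of_discrete (f := fun n : ℕ => x p ^ n)).comp (measurable_pi_apply p)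
  rw [integral_map hm.aemeasurable hmono.aestronglyMeasurable]
  simp only [prod_pow_X]
  rw [integral_prod_prod_mark _ (ψ := fun l y => pointWeight s x l (y (κ l)))
    (fun l => (Measurable.of_discrete (f := pointWeight s x l)).comp (measurable_pi_apply _))
    fun l y => pointWeight_mem_Icc hx _ _]
  have hind : iIndepFun (fun (p : ℕ × ℕ) (c : ℕ × ℕ → ℕ) => c p) (Measure.infinitePi
      fun p : ℕ × ℕ => poissonMeasure (poissonMass (κ p.1) p.2 / (p.1 : ℝ≥0))) :=
    iIndepFun_infinitePi (X := fun _ => id) fun _ => measurable_id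
  rw [integral_finset_prod_comp hind (fun p => measurable_pi_apply p) s (f := fun p n => x p ^ n)
    fun p => .of_discrete]
  have hmarg (p : ℕ × ℕ) : ∫ c : ℕ × ℕ → ℕ, x p ^ c p ∂(Measure.infinitePi
      fun p : ℕ × ℕ => poissonMeasure (poissonMass (κ p.1) p.2 / (p.1 : ℝ≥0))) =
        Real.exp ((poissonMass (κ p.1) p.2 : ℝ) * (x p - 1) / p.1) := by
    rw [← integral_map (φ := fun c : ℕ × ℕ → ℕ => c p) (f := fun n : ℕ => x p ^ n)
      (measurable_pi_apply p).aemeasurable .of_discrete, Measure.infinitePi_map_eval,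
      integral_pow_poissonMeasure]
    congr 1
    push_cast
    ring
  simp only [hmarg, integral_pointWeight, add_sub_cancel_left]
  rw [← Real.exp_sum, ← Finset.sum_fiberwise_of_maps_to (g := Prod.fst) (t := s.image Prod.fst)
    fun p hp => Finset.mem_image_of_mem _ hp]
  congr 1
  refine Finset.sum_congr rfl fun l _ => ?_
  rw [Finset.sum_div]
  refine Finset.sum_congr rfl fun p hp => ?_
  rw [(Finset.mem_filter.1 hp).2]

lemma map_X (l k j : ℕ) :
    limitMeasure.map (X l k j) = poissonMeasure (poissonMass k j / (l : ℝ≥0)) := by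
  have h := congrArg (Measure.map fun c : ℕ × ℕ → ℕ => c (l, j)) (map_X_eq_infinitePi fun _ => k)
  rw [Measure.infinitePi_map_eval, Measure.map_map (measurable_pi_apply _)
    (measurable_pi_iff.2 fun p => measurable_X _ _ _)] at h
  exact h

lemma iIndepFun_X (κ : ℕ → ℕ) :
    iIndepFun (fun q : ℕ × ℕ => X q.1 (κ q.1) q.2) limitMeasure := by
  rw [iIndepFun_iff_map_fun_eq_infinitePi_map fun p => measurable_X _ _ _, map_X_eq_infinitePi]
  simp only [map_X]

/-! ### The variables `A` -/

/-- The number of all cycles of length `k` attached to the cycles of length `l`. -/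
def attached (l k : ℕ) (ω : LimitSpace) : ℕ := ∑ m ∈ Finset.range (ω.1 l), mark l m ω.2 k

lemma X_eq_zero {l k j : ℕ} {ω : LimitSpace}
    (hj : j ∉ (Finset.range (ω.1 l)).image fun m => ω.2 (l, m, k)) : X l k j ω = 0 := by
  rw [X, Finset.card_eq_zero, Finset.filter_eq_empty_iff]
  exact fun m hm h => hj (Finset.mem_image.2 ⟨m, hm, h⟩)

lemma summable_mul_X (l k : ℕ) (ω : LimitSpace) : Summable fun j : ℕ => j * X l k j ω :=
  summable_of_ne_finset_zero (s := (Finset.range (ω.1 l)).image fun m => ω.2 (l, m, k))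
    fun j hj => by rw [X_eq_zero hj, mul_zero]

lemma tsum_mul_X (l k : ℕ) (ω : LimitSpace) : ∑' j : ℕ, j * X l k j ω = attached l k ω := by
  rw [tsum_eq_sum (s := (Finset.range (ω.1 l)).image fun m => ω.2 (l, m, k))
    fun j hj => by rw [X_eq_zero hj, mul_zero]]
  have h := Finset.sum_comp (s := Finset.range (ω.1 l)) (fun j : ℕ => j) fun m => ω.2 (l, m, k)
  refine Eq.trans ?_ h.symm
  refine Finset.sum_congr rfl fun j _ => ?_
  rw [smul_eq_mul, mul_comm]
  rfl

lemma A_eq (ω : LimitSpace) (i : ℕ+) :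
    A ω i = ∑ q ∈ (i : ℕ).divisorsAntidiagonal, attached q.2 q.1 ω := by
  simp only [A, tsum_mul_X]

/-- `attached` as a function of the coordinates belonging to the cycles of length `l`. -/
def levelAttached (k : ℕ) (c : Option (ℕ × ℕ) → ℕ) : ℕ :=
  ∑ m ∈ Finset.range (c none), c (some (m, k))

lemma measurable_levelAttached (k : ℕ) : Measurable (levelAttached k) := by
  have h : Measurable fun p : ℕ × (Option (ℕ × ℕ) → ℕ) =>
      ∑ m ∈ Finset.range p.1, p.2 (some (m, k)) :=
    measurable_from_prod_countable_right fun n => by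
      dsimp only
      exact Finset.measurable_fun_sum _ fun m _ => measurable_pi_apply _
  have hc : Measurable fun c : Option (ℕ × ℕ) → ℕ => (c none, c) :=
    (measurable_pi_apply none).prodMk measurable_id
  exact h.comp hc

lemma measurable_attached (l k : ℕ) : Measurable (attached l k) :=
  (measurable_levelAttached k).comp (measurable_levelCoord l)

lemma measurable_A : Measurable A := by
  refine measurable_pi_iff.2 fun i => ?_
  simp only [A_eq]
  exact Finset.measurable_fun_sum _ fun q _ => measurable_attached q.2 q.1

lemma prod_pow_A {s : Finset ℕ+} {b : ℕ} (hb : ∀ i ∈ s, (i : ℕ) ≤ b) (x : ℕ+ → ℝ) (ω : LimitSpace) :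
    ∏ i ∈ s, x i ^ A ω i = ∏ l ∈ Finset.Icc 1 b, ∏ m ∈ Finset.range (ω.1 l),
      ∏ j ∈ Finset.Icc 1 b, lengthWeight s x (l * j) ^ mark l m ω.2 j := by
  have hR (l : ℕ) : ∏ m ∈ Finset.range (ω.1 l),
      ∏ j ∈ Finset.Icc 1 b, lengthWeight s x (l * j) ^ mark l m ω.2 j =
        ∏ j ∈ Finset.Icc 1 b, ∏ i ∈ s, if (i : ℕ) = l * j then x i ^ attached l j ω else 1 := by
    rw [Finset.prod_comm]
    refine Finset.prod_congr rfl fun j _ => ?_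
    rw [Finset.prod_pow_eq_pow_sum, lengthWeight, ← Finset.prod_pow, Finset.prod_filter]
    rfl
  simp only [hR]
  rw [← Finset.prod_product' (f := fun l j => ∏ i ∈ s, if (i : ℕ) = l * j then
    x i ^ attached l j ω else 1), Finset.prod_comm]
  refine Finset.prod_congr rfl fun i hi => ?_
  rw [A_eq, ← Finset.prod_pow_eq_pow_sum, ← Finset.prod_filter]
  refine Finset.prod_bij (fun q _ => (q.2, q.1)) (fun q hq => ?_)
    (fun q _ q' _ h => by simpa [Prod.ext_iff, and_comm] using h) (fun q hq => ?_) fun _ _ => rfl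
  · obtain ⟨hq, hi0⟩ := Nat.mem_divisorsAntidiagonal.1 hq
    have h1 : q.1 ≠ 0 := by rintro h; simp [h] at hq; omega
    have h2 : q.2 ≠ 0 := by rintro h; simp [h] at hq; omega
    have h3 := Nat.le_mul_of_pos_right q.1 (Nat.pos_of_ne_zero h2)
    have h4 := Nat.le_mul_of_pos_left q.2 (Nat.pos_of_ne_zero h1)
    have := hb i hi
    simp only [Finset.mem_filter, Finset.mem_product, Finset.mem_Icc]
    refine ⟨⟨⟨?_, ?_⟩, ?_, ?_⟩, by rw [← hq, mul_comm]⟩ <;> omega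
  · refine ⟨(q.2, q.1), ?_, rfl⟩
    rw [Nat.mem_divisorsAntidiagonal, (Finset.mem_filter.1 hq).2.trans (mul_comm q.1 q.2)]
    have := (Finset.mem_filter.1 hq).2
    exact ⟨rfl, by rw [mul_comm, ← this]; exact i.ne_zero⟩

/-- The joint generating function of the variables `A`. -/
theorem integral_prod_pow_A {s : Finset ℕ+} {b : ℕ} (hb : ∀ i ∈ s, (i : ℕ) ≤ b) {x : ℕ+ → ℝ}
    (hx : ∀ i, x i ∈ Set.Icc (0 : ℝ) 1) :
    ∫ ω, ∏ i ∈ s, x i ^ A ω i ∂limitMeasure = Real.exp (∑ l ∈ Finset.Icc 1 b,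
      (Real.exp (∑ j ∈ Finset.Icc 1 b, (lengthWeight s x (l * j) - 1) / j) - 1) / l) := by
  have hmono (l : ℕ) : Measurable fun y : ℕ → ℕ =>
      ∏ j ∈ Finset.Icc 1 b, lengthWeight s x (l * j) ^ y j :=
    Finset.measurable_fun_prod _ fun j _ =>
      (Measurable.of_discrete (f := fun n : ℕ => lengthWeight s x (l * j) ^ n)).comp
        (measurable_pi_apply j)
  simp only [prod_pow_A hb]
  rw [integral_prod_prod_mark _
    (ψ := fun l y => ∏ j ∈ Finset.Icc 1 b, lengthWeight s x (l * j) ^ y j) hmono]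
  · have hind : iIndepFun (fun (k : ℕ) (y : ℕ → ℕ) => y k) markMeasure :=
      iIndepFun_infinitePi (X := fun _ => id) fun _ => measurable_id
    congr 1
    refine Finset.sum_congr rfl fun l _ => ?_
    rw [integral_finset_prod_comp hind (fun k => measurable_pi_apply k) _
      (f := fun j n => lengthWeight s x (l * j) ^ n) fun j => .of_discrete, Real.exp_sum]
    congr 2
    refine Finset.prod_congr rfl fun j _ => ?_
    rw [integral_markMeasure_eval j fun n => lengthWeight s x (l * j) ^ n,
      integral_pow_poissonMeasure]
    congr 1
    push_cast
    ring
  · exact fun l y => ⟨Finset.prod_nonneg fun j _ => pow_nonneg (lengthWeight_mem_Icc hx _).1 _,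
      Finset.prod_le_one (fun j _ => pow_nonneg (lengthWeight_mem_Icc hx _).1 _)
        fun j _ => pow_le_one₀ (lengthWeight_mem_Icc hx _).1 (lengthWeight_mem_Icc hx _).2⟩

end WreathCycles

namespace WreathCycles

/-! ### Moments -/

lemma measurePreserving_coord (q : ℕ × ℕ × ℕ) :
    MeasurePreserving (fun y : ℕ × ℕ × ℕ → ℕ => y q) marksMeasure
      (poissonMeasure (1 / (q.2.2 : ℝ≥0))) :=
  measurePreserving_eval_infinitePi (fun q : ℕ × ℕ × ℕ => poissonMeasure (1 / (q.2.2 : ℝ≥0))) q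

lemma measurePreserving_count (l : ℕ) :
    MeasurePreserving (fun N : ℕ → ℕ => N l) countsMeasure (poissonMeasure (1 / (l : ℝ≥0))) :=
  measurePreserving_eval_infinitePi (fun l : ℕ => poissonMeasure (1 / (l : ℝ≥0))) l

section Transfer

variable {Ω : Type*} [MeasurableSpace Ω] {P : Measure Ω} {Z : Ω → ℕ} {r : ℝ≥0}

lemma integrable_comp_of_poisson (hZ : MeasurePreserving Z P (poissonMeasure r)) {f : ℕ → ℝ}
    (hf : Integrable f (poissonMeasure r)) : Integrable (fun ω => f (Z ω)) P :=
  hZ.integrable_comp_of_integrable hf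

lemma integral_comp_of_poisson (hZ : MeasurePreserving Z P (poissonMeasure r)) (f : ℕ → ℝ) :
    ∫ ω, f (Z ω) ∂P = ∫ n, f n ∂poissonMeasure r := by
  rw [← hZ.map_eq, integral_map hZ.measurable.aemeasurable .of_discrete]

end Transfer

lemma memLp_coord (q : ℕ × ℕ × ℕ) : MemLp (fun y : ℕ × ℕ × ℕ → ℕ => (y q : ℝ)) 2 marksMeasure :=
  (memLp_two_iff_integrable_sq (Measurable.of_discrete.comp
    (measurable_pi_apply q)).aestronglyMeasurable).2
    (integrable_comp_of_poisson (measurePreserving_coord q) (integrable_sq_poissonMeasure _))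

/-- The sum of the entries `k` of the first `n` marks at level `l`. -/
def partialAttached (l k n : ℕ) (y : ℕ × ℕ × ℕ → ℕ) : ℝ := ∑ m ∈ Finset.range n, (y (l, m, k) : ℝ)

lemma memLp_partialAttached (l k n : ℕ) : MemLp (partialAttached l k n) 2 marksMeasure :=
  memLp_finsetSum _ fun m _ => memLp_coord (l, m, k)

lemma integral_partialAttached (l k n : ℕ) :
    ∫ y, partialAttached l k n y ∂marksMeasure = n * (1 / k) := by
  simp only [partialAttached]
  rw [integral_finsetSum _ fun m _ => (memLp_coord (l, m, k)).integrable one_le_two]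
  have (m : ℕ) : ∫ y : ℕ × ℕ × ℕ → ℕ, (y (l, m, k) : ℝ) ∂marksMeasure = 1 / k := by
    rw [integral_comp_of_poisson (measurePreserving_coord (l, m, k)) fun n => (n : ℝ),
      integral_id_poissonMeasure]
    simp
  simp [this]

lemma integral_sq_partialAttached (l k n : ℕ) :
    ∫ y, partialAttached l k n y ^ 2 ∂marksMeasure = n * (1 / k) + (n : ℝ) ^ 2 * (1 / k) ^ 2 := by
  have hvar (m : ℕ) : variance (fun y : ℕ × ℕ × ℕ → ℕ => (y (l, m, k) : ℝ)) marksMeasure =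
      1 / k := by
    rw [variance_eq_sub (memLp_coord (l, m, k))]
    simp only [Pi.pow_apply]
    rw [integral_comp_of_poisson (measurePreserving_coord (l, m, k)) fun n => (n : ℝ) ^ 2,
      integral_comp_of_poisson (measurePreserving_coord (l, m, k)) fun n => (n : ℝ),
      integral_sq_poissonMeasure, integral_id_poissonMeasure]
    simp
  have hsum : variance (partialAttached l k n) marksMeasure = n * (1 / k) := by
    have h := IndepFun.variance_sum (μ := marksMeasure) (s := Finset.range n)
      (X := fun m (y : ℕ × ℕ × ℕ → ℕ) => (y (l, m, k) : ℝ)) (fun m _ => memLp_coord (l, m, k))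
      fun m _ m' _ hm => (iIndepFun_coord.indepFun
        (show (l, m, k) ≠ (l, m', k) by simpa using hm)).comp .of_discrete .of_discrete
    rw [show partialAttached l k n = ∑ m ∈ Finset.range n,
      fun y : ℕ × ℕ × ℕ → ℕ => (y (l, m, k) : ℝ) by ext y; simp [partialAttached], h]
    simp [hvar]
  rw [variance_eq_sub (memLp_partialAttached l k n), integral_partialAttached] at hsum
  simp only [Pi.pow_apply] at hsum
  linarith [mul_pow (n : ℝ) (1 / k) 2]

lemma attached_eq_partialAttached (l k : ℕ) (ω : LimitSpace) :
    (attached l k ω : ℝ) = partialAttached l k (ω.1 l) ω.2 := by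
  simp [attached, partialAttached, mark]

lemma integrable_count (l : ℕ) : Integrable (fun N : ℕ → ℕ => (N l : ℝ)) countsMeasure :=
  integrable_comp_of_poisson (measurePreserving_count l) (integrable_id_poissonMeasure _)

lemma integrable_count_sq (l : ℕ) : Integrable (fun N : ℕ → ℕ => (N l : ℝ) ^ 2) countsMeasure :=
  integrable_comp_of_poisson (measurePreserving_count l) (integrable_sq_poissonMeasure _)

lemma integral_count (l : ℕ) : ∫ N : ℕ → ℕ, (N l : ℝ) ∂countsMeasure = 1 / l := by
  rw [integral_comp_of_poisson (measurePreserving_count l) fun n => (n : ℝ),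
    integral_id_poissonMeasure]
  simp

lemma integral_count_sq (l : ℕ) :
    ∫ N : ℕ → ℕ, (N l : ℝ) ^ 2 ∂countsMeasure = 1 / l + (1 / l) ^ 2 := by
  rw [integral_comp_of_poisson (measurePreserving_count l) fun n => (n : ℝ) ^ 2,
    integral_sq_poissonMeasure]
  simp

lemma measurable_attached_cast (l k : ℕ) : Measurable fun ω : LimitSpace => (attached l k ω : ℝ) :=
  Measurable.of_discrete.comp (measurable_attached l k)

lemma integrable_attached_sq (l k : ℕ) :
    Integrable (fun ω : LimitSpace => (attached l k ω : ℝ) ^ 2) limitMeasure := by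
  rw [limitMeasure_eq_prod, integrable_prod_iff ((measurable_attached_cast l k).pow_const
    2).aestronglyMeasurable]
  simp only [attached_eq_partialAttached]
  refine ⟨ae_of_all _ fun N => (memLp_partialAttached l k _).integrable_sq, ?_⟩
  simp only [Real.norm_of_nonneg (sq_nonneg _), integral_sq_partialAttached]
  exact ((integrable_count l).mul_const _).add ((integrable_count_sq l).mul_const _)

lemma memLp_attached (l k : ℕ) :
    MemLp (fun ω : LimitSpace => (attached l k ω : ℝ)) 2 limitMeasure :=
  (memLp_two_iff_integrable_sq (measurable_attached_cast l k).aestronglyMeasurable).2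
    (integrable_attached_sq l k)

lemma integral_attached (l k : ℕ) :
    ∫ ω, (attached l k ω : ℝ) ∂limitMeasure = 1 / l * (1 / k) := by
  have hint := (memLp_attached l k).integrable one_le_two
  rw [limitMeasure_eq_prod] at hint ⊢
  rw [integral_prod _ hint]
  simp only [attached_eq_partialAttached, integral_partialAttached]
  rw [integral_mul_const, integral_count]

lemma variance_attached (l k : ℕ) :
    variance (fun ω => (attached l k ω : ℝ)) limitMeasure =
      1 / l * (1 / k) + 1 / l * (1 / k) ^ 2 := by
  have hint := integrable_attached_sq l k
  rw [variance_eq_sub (memLp_attached l k), integral_attached]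
  simp only [Pi.pow_apply]
  rw [limitMeasure_eq_prod] at hint ⊢
  rw [integral_prod _ hint]
  simp only [attached_eq_partialAttached, integral_sq_partialAttached]
  rw [integral_add ((integrable_count l).mul_const _) ((integrable_count_sq l).mul_const _),
    integral_mul_const, integral_mul_const, integral_count, integral_count_sq]
  ring

lemma A_cast_eq (i : ℕ+) : (fun ω => (A ω i : ℝ)) =
    ∑ q ∈ (i : ℕ).divisorsAntidiagonal, fun ω : LimitSpace => (attached q.2 q.1 ω : ℝ) := by
  ext ω
  simp [A_eq]

lemma one_div_mul_one_div_of_mem {i : ℕ} {q : ℕ × ℕ} (hq : q ∈ i.divisorsAntidiagonal) :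
    1 / (q.2 : ℝ) * (1 / q.1) = 1 / i := by
  rw [← (Nat.mem_divisorsAntidiagonal.1 hq).1, Nat.cast_mul, one_div_mul_one_div, mul_comm]

lemma card_divisorsAntidiagonal (i : ℕ) : i.divisorsAntidiagonal.card = i.divisors.card := by
  rw [← Nat.map_div_right_divisors, Finset.card_map]

lemma memLp_A (i : ℕ+) : MemLp (fun ω => (A ω i : ℝ)) 2 limitMeasure := by
  rw [A_cast_eq]
  exact memLp_finsetSum' _ fun q _ => memLp_attached q.2 q.1

lemma integral_A (i : ℕ+) :
    ∫ ω, (A ω i : ℝ) ∂limitMeasure = ((i : ℕ).divisors.card : ℝ) / (i : ℝ) := by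
  simp only [A_eq, Nat.cast_sum]
  rw [integral_finsetSum _ fun q _ => (memLp_attached q.2 q.1).integrable one_le_two,
    Finset.sum_congr rfl fun q hq =>
      (integral_attached q.2 q.1).trans (one_div_mul_one_div_of_mem hq)]
  rw [Finset.sum_const, card_divisorsAntidiagonal, nsmul_eq_mul, mul_one_div]

/-- The terms of `A i` belong to different `l`, hence are independent. -/
lemma variance_A (i : ℕ+) :
    variance (fun ω => (A ω i : ℝ)) limitMeasure = ((i : ℕ).divisors.card : ℝ) / (i : ℝ) +
      1 / (i : ℝ) * ∑ l ∈ (i : ℕ).divisors, 1 / (l : ℝ) := by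
  rw [A_cast_eq, IndepFun.variance_sum (fun q _ => memLp_attached q.2 q.1)]
  · have hterm (q : ℕ × ℕ) (hq : q ∈ (i : ℕ).divisorsAntidiagonal) :
        variance (fun ω => (attached q.2 q.1 ω : ℝ)) limitMeasure =
          1 / (i : ℝ) + 1 / (i : ℝ) * (1 / q.1) := by
      rw [variance_attached, sq, ← mul_assoc, one_div_mul_one_div_of_mem hq]
    rw [Finset.sum_congr rfl hterm, Finset.sum_add_distrib, Finset.sum_const,
      card_divisorsAntidiagonal, nsmul_eq_mul, mul_one_div, ← Finset.mul_sum,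
      Nat.sum_divisorsAntidiagonal fun k _ => 1 / (k : ℝ)]
  · intro q hq q' hq' hne
    have hne2 : q.2 ≠ q'.2 := by
      intro h
      have h1 := Nat.mem_divisorsAntidiagonal.1 hq
      have h2 := (Nat.mem_divisorsAntidiagonal.1 hq').1
      have hpos : 0 < q.2 := Nat.pos_of_ne_zero fun h0 => h1.2 (by rw [← h1.1, h0, mul_zero])
      refine hne (Prod.ext (Nat.eq_of_mul_eq_mul_right hpos ?_) h)
      rw [h1.1, h, h2]
    exact (iIndepFun_levelCoord.indepFun hne2).comp
      (φ := fun c => (levelAttached q.1 c : ℝ)) (ψ := fun c => (levelAttached q'.1 c : ℝ))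
      (Measurable.of_discrete.comp (measurable_levelAttached _))
      (Measurable.of_discrete.comp (measurable_levelAttached _))

/-! ### Convergence of the cycle counts -/

theorem tendstoInDistribution_cycleCounts :
    TendstoInDistribution
      (fun (p : ℕ × ℕ) (σ : wreathSubgroup p.1 p.2) => cycleCounts σ.1)
      (atTop ×ˢ atTop) A
      (fun p => uniformOn (Set.univ : Set (wreathSubgroup p.1 p.2))) limitMeasure where
  forall_aemeasurable p := (measurable_from_top : Measurable
    fun σ : wreathSubgroup p.1 p.2 => cycleCounts σ.1).aemeasurable
  aemeasurable_limit := measurable_A.aemeasurable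
  tendsto := by
    refine tendsto_of_tendsto_pgf fun s x hx => ?_
    have hmono : Measurable fun c : ℕ+ → ℕ => ∏ i ∈ s, x i ^ c i :=
      Finset.measurable_fun_prod _ fun i _ =>
        (Measurable.of_discrete (f := fun n : ℕ => x i ^ n)).comp (measurable_pi_apply i)
    have hm (p : ℕ × ℕ) : Measurable fun σ : wreathSubgroup p.1 p.2 => cycleCounts σ.1 :=
      measurable_from_top
    simp only [ProbabilityMeasure.coe_mk]
    rw [integral_map measurable_A.aemeasurable hmono.aestronglyMeasurable,
      integral_prod_pow_A (b := s.sup fun j : ℕ+ => (j : ℕ))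
        (fun i hi => Finset.le_sup (f := fun j : ℕ+ => (j : ℕ)) hi) hx]
    refine (tendsto_integral_prod_parts (lengthWeight_mem_Icc hx)
      fun i hi => lengthWeight_eq_one hi).congr fun p => ?_
    rw [integral_map (hm p).aemeasurable hmono.aestronglyMeasurable]
    simp only [prod_map_lengthWeight]
    rfl

end WreathCycles

end
theorem theoremA1 :
    -- `X_{l,k,j}` is Poisson with parameter `p^k_j / l`
    (∀ l k j : ℕ, 0 < l → 0 < k →
      HasLaw (WreathCycles.X l k j) (poissonMeasure (WreathCycles.poissonMass k j / (l : ℝ≥0)))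
        WreathCycles.limitMeasure) ∧
    -- for any choice of one `k` for each `l`, the variables `X_{l,k,j}` are mutually independent
    (∀ κ : ℕ → ℕ,
      iIndepFun (fun q : ℕ × ℕ => WreathCycles.X q.1 (κ q.1) q.2) WreathCycles.limitMeasure) ∧
    -- the families `(X_{l,k,j})_{k,j}`, one for each `l`, are mutually independent
    iIndepFun (fun (l : ℕ) (ω : WreathCycles.LimitSpace) (q : ℕ × ℕ) =>
      WreathCycles.X l q.1 q.2 ω) WreathCycles.limitMeasure ∧
    -- the series that define the `A_i` converge
    (∀ (l k : ℕ) (ω : WreathCycles.LimitSpace),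
      Summable fun j : ℕ => j * WreathCycles.X l k j ω) ∧
    -- joint convergence in law of the cycle counts, as both `k` and `n` tend to infinity
    TendstoInDistribution
      (fun (p : ℕ × ℕ) (σ : WreathCycles.wreathSubgroup p.1 p.2) => WreathCycles.cycleCounts σ.1)
      (atTop ×ˢ atTop) WreathCycles.A
      (fun p => uniformOn (Set.univ : Set (WreathCycles.wreathSubgroup p.1 p.2)))
      WreathCycles.limitMeasure ∧
    -- expectation and variance of `A_i`
    (∀ i : ℕ+,
      MemLp (fun ω => (WreathCycles.A ω i : ℝ)) 2 WreathCycles.limitMeasure ∧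
      ∫ ω, (WreathCycles.A ω i : ℝ) ∂WreathCycles.limitMeasure =
        ((i : ℕ).divisors.card : ℝ) / (i : ℝ) ∧
      variance (fun ω => (WreathCycles.A ω i : ℝ)) WreathCycles.limitMeasure =
        ((i : ℕ).divisors.card : ℝ) / (i : ℝ) +
          1 / (i : ℝ) * ∑ l ∈ (i : ℕ).divisors, 1 / (l : ℝ)) :=
  ⟨fun l k j _ _ => ⟨(WreathCycles.measurable_X l k j).aemeasurable, WreathCycles.map_X l k j⟩,
    WreathCycles.iIndepFun_X, WreathCycles.iIndepFun_X_families, WreathCycles.summable_mul_X,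
    WreathCycles.tendstoInDistribution_cycleCounts,
    fun i => ⟨WreathCycles.memLp_A i, WreathCycles.integral_A i, WreathCycles.variance_A i⟩⟩
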